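/- \textbf{Setting.} Let $\mathfrak X$ be a linearly ordered set that is order-isomorphic to $\mathbb Z$ or to $\mathbb N$, let $\Omega=\{0,1\}^{\mathfrak X}$ be the space of point configurations with its product (Borel) $\sigma$-algebra, and let $\mathfrak S$ be the group of finite permutations of $\mathfrak X$, acting on $\Omega$ by $g(\omega)=\{g(x):x\in\omega\}$. A probability measure $M$ on $\Omega$ is a determinantal point process (DPP) with correlation kernel $K$ if $M(\omega(x_1)=\dots=\omega(x_n)=1)=\det[K(x_i,x_j)]_{1\le i,j\le n}$ for all distinct $x_1,\dots,x_n$. It is $\mathfrak S$-quasi-invariant if $M$ and its image ${}^gM$ under $g$ are mutually absolutely continuous for every $g\in\mathfrak S$. Let $\mathcal K=\ell^2(\mathfrak X)\oplus\ell^2(\mathfrak X)$ and $\Gamma(u,v)=(Jv,Ju)$ with $J$ the complex conjugation. The CAR algebra $\mathcal C(\mathcal K,\Gamma)$ is the C*-completion of the $*$-algebra generated by $B(f)$, $f\in\mathcal K$, linear in $f$, with $B(f)^*=B(\Gamma f)$ and $B(f)^*B(g)+B(g)B(f)^*=(f,g)$ (the inner product being linear in $g$). Put $a_x=B((0,e_x))$,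 and let $\mathcal A(\mathcal K,\Gamma)$ be the closed $*$-subalgebra generated by all $a_x^*a_y$. A state $\varphi$ on $\mathcal C(\mathcal K,\Gamma)$ is quasi-free if it satisfies Wick's formula: $\varphi(B(f_1)\cdots B(f_{2n+1}))=0$ and $\varphi(B(f_1)\cdots B(f_{2n}))=(-1)^{n(n-1)/2}\sum_\sigma \operatorname{sgn}\sigma\prod_{i=1}^n\varphi(B(f_{\sigma(i)})B(f_{\sigma(i+n)}))$, the sum being over $\sigma\in\mathfrak S_{2n}$ with $\sigma(1)<\dots<\sigma(n)$ and $\sigma(i)<\sigma(i+n)$. Put $\eta_x=1-2a_x^*a_x$ and $\eta_{(x,y)}=\prod_{x<z<y}\eta_z$. For an $\mathfrak S$-quasi-invariant $M$, let $\mathcal T^M$ be the $*$-representation of $\mathcal A(\mathcal K,\Gamma)$ on $L^2(\Omega,M)$ under which $\eta_x$ acts as multiplication by $1-2\omega(x)$, and for $x<y$ the element \[\tfrac12(1+\eta_x\eta_y)+\tfrac12\bigl(1+\eta_x\eta_y+(1-\eta_x\eta_y)\eta_{(x,y)}\bigr)(a_x^*a_y+a_y^*a_x)\] acts as the Koopman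 operator $h\mapsto h(s^{-1}\omega)\,\bigl(\tfrac{d({}^sM)}{dM}(\omega)\bigr)^{1/2}$ of the transposition $s=s_{x,y}$ of $x$ and $y$. The measure $M$ is called \emph{perfect} if it is $\mathfrak S$-quasi-invariant and the state $A\mapsto(1,\mathcal T^M(A)1)_{L^2(\Omega,M)}$ on $\mathcal A(\mathcal K,\Gamma)$ is the restriction of a quasi-free state on $\mathcal C(\mathcal K,\Gamma)$. \textbf{Proposition.} (i) Let $v_1,\dots,v_N\in\ell^2(\mathfrak X)$ be linearly independent, and suppose that $\det(v_i(x_j))_{1\le i,j\le N}$ is real and $\ge 0$ whenever $x_1>\dots>x_N$. Let $K$ be the orthogonal projection of $\ell^2(\mathfrak X)$ onto the span of $v_1,\dots,v_N$. Then there is exactly one DPP $M$ on $\mathfrak X$ with correlation kernel $K(x,y)=(e_x,Ke_y)$, and if $M$ is $\mathfrak S$-quasi-invariant, then $M$ is perfect. (ii) (Discrete orthogonal polynomial ensembles.) Let $\mathfrak X\subset\mathbb R$, with the induced order, be order-isomorphic to $\mathbb Z$ or $\mathbb N$, and let $W:\mathfrak X\to(0,\infty)$ satisfy $\sum_{x\in\mathfrak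 X}x^{2k}W(x)<\infty$ for $0\le k<N$. Then the functions $v_n(x)=x^{N-n}W(x)^{1/2}$, $n=1,\dots,N$, lie in $\ell^2(\mathfrak X)$, are linearly independent and satisfy the condition in (i), and the corresponding DPP exists, is unique, and is perfect (in particular $\mathfrak S$-quasi-invariant). -/

import Mathlib

open scoped ComplexOrder

/-! ## The self-dual CAR algebra of a Hilbert space with an antiunitary involution -/

/-- An antiunitary involution `Γ` of a complex Hilbert space. -/
structure AntiunitaryInvolution (𝒦 : Type*) [NormedAddCommGroup 𝒦] [InnerProductSpace ℂ 𝒦] where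
  toMap : 𝒦 →ₛₗ[starRingEnd ℂ] 𝒦
  involutive : ∀ f, toMap (toMap f) = f
  inner_map : ∀ f g, inner ℂ (toMap f) (toMap g) = inner ℂ g f

/-- `Aᵐᵒᵖ` with the complex conjugate scalar action: a `ℂ`-algebra morphism into it is the same
thing as an antilinear antimultiplicative map into `A`. -/
def ConjOp (A : Type*) : Type _ := Aᵐᵒᵖ

namespace ConjOp

variable {A : Type*}

/-- The identity map `A → ConjOp A`. -/
def mk (a : A) : ConjOp A := MulOpposite.op a

/-- The identity map `ConjOp A → A`. -/
def un (a : ConjOp A) : A := MulOpposite.unop a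

theorem un_mk (a : A) : un (mk a) = a := rfl
theorem mk_un (a : ConjOp A) : mk (un a) = a := rfl

variable [Ring A]

instance : Ring (ConjOp A) := inferInstanceAs (Ring Aᵐᵒᵖ)

theorem mk_mul (a b : A) : mk (a * b) = mk b * mk a := rfl
theorem mk_add (a b : A) : mk (a + b) = mk a + mk b := rfl
theorem un_mul (a b : ConjOp A) : un (a * b) = un b * un a := rfl
theorem un_add (a b : ConjOp A) : un (a + b) = un a + un b := rfl

variable [Algebra ℂ A]

noncomputable instance : Algebra ℂ (ConjOp A) :=
  RingHom.toAlgebra' (S := Aᵐᵒᵖ) ((algebraMap ℂ Aᵐᵒᵖ).comp (starRingEnd ℂ))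
    (fun c x => Algebra.commutes (A := Aᵐᵒᵖ) (starRingEnd ℂ c) x)

theorem un_algebraMap (c : ℂ) :
    un (algebraMap ℂ (ConjOp A) c) = algebraMap ℂ A (starRingEnd ℂ c) := rfl
theorem mk_smul (c : ℂ) (a : A) : mk (c • a) = starRingEnd ℂ c • mk a := by
  rw [Algebra.smul_def (starRingEnd ℂ c) (mk a)]
  change MulOpposite.op (c • a)
    = algebraMap ℂ Aᵐᵒᵖ (starRingEnd ℂ (starRingEnd ℂ c)) * MulOpposite.op a
  rw [Complex.conj_conj, ← Algebra.smul_def, MulOpposite.op_smul]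

end ConjOp

namespace CAR

variable {𝒦 : Type*} [NormedAddCommGroup 𝒦] [InnerProductSpace ℂ 𝒦]

/-- The defining relations between the generators `B(f)`: linearity, and
`B(Γf) B(g) + B(g) B(Γf) = (f, g)`. -/
inductive Rel (Γ : AntiunitaryInvolution 𝒦) : FreeAlgebra ℂ 𝒦 → FreeAlgebra ℂ 𝒦 → Prop
  | add (f g : 𝒦) :
      Rel Γ (FreeAlgebra.ι ℂ (f + g)) (FreeAlgebra.ι ℂ f + FreeAlgebra.ι ℂ g)
  | smul (c : ℂ) (f : 𝒦) :
      Rel Γ (FreeAlgebra.ι ℂ (c • f)) (c • FreeAlgebra.ι ℂ f)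
  | anticomm (f g : 𝒦) :
      Rel Γ (FreeAlgebra.ι ℂ (Γ.toMap f) * FreeAlgebra.ι ℂ g
          + FreeAlgebra.ι ℂ g * FreeAlgebra.ι ℂ (Γ.toMap f))
        (algebraMap ℂ (FreeAlgebra ℂ 𝒦) (inner ℂ f g))

/-- The algebra `𝒞₀(𝒦, Γ)` given by generators `B(f)`, `f ∈ 𝒦`, and the relations above. -/
def Alg (Γ : AntiunitaryInvolution 𝒦) : Type _ := RingQuot (Rel Γ)

variable (Γ : AntiunitaryInvolution 𝒦)

noncomputable instance algRing : Ring (Alg Γ) := inferInstanceAs (Ring (RingQuot (Rel Γ)))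
noncomputable instance algAlgebra : Algebra ℂ (Alg Γ) :=
  inferInstanceAs (Algebra ℂ (RingQuot (Rel Γ)))

/-- The quotient map from the free algebra. -/
noncomputable def quot : FreeAlgebra ℂ 𝒦 →ₐ[ℂ] Alg Γ := RingQuot.mkAlgHom ℂ (Rel Γ)

/-- The generators `B(f)` of `𝒞₀(𝒦, Γ)`. -/
noncomputable def B₀ (f : 𝒦) : Alg Γ := quot Γ (FreeAlgebra.ι ℂ f)

theorem B₀_add (f g : 𝒦) : B₀ Γ (f + g) = B₀ Γ f + B₀ Γ g := by
  have h := RingQuot.mkAlgHom_rel ℂ (Rel.add (Γ := Γ) f g)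
  rw [map_add] at h
  exact h

theorem B₀_smul (c : ℂ) (f : 𝒦) : B₀ Γ (c • f) = c • B₀ Γ f := by
  have h := RingQuot.mkAlgHom_rel ℂ (Rel.smul (Γ := Γ) c f)
  rw [map_smul] at h
  exact h

theorem B₀_anticomm (f g : 𝒦) :
    B₀ Γ (Γ.toMap f) * B₀ Γ g + B₀ Γ g * B₀ Γ (Γ.toMap f)
      = algebraMap ℂ (Alg Γ) (inner ℂ f g) := by
  have h := RingQuot.mkAlgHom_rel ℂ (Rel.anticomm (Γ := Γ) f g)
  rw [map_add, map_mul, map_mul, AlgHom.commutes] at h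
  exact h

theorem alg_induction {P : Alg Γ → Prop} (scalar : ∀ c : ℂ, P (algebraMap ℂ _ c))
    (gen : ∀ f, P (B₀ Γ f)) (mul : ∀ a b, P a → P b → P (a * b))
    (add : ∀ a b, P a → P b → P (a + b)) (a : Alg Γ) : P a := by
  obtain ⟨x, rfl⟩ : ∃ x, quot Γ x = a := RingQuot.mkAlgHom_surjective ℂ (Rel Γ) a
  induction x using FreeAlgebra.induction with
  | grade0 c => rw [AlgHom.commutes]; exact scalar c
  | grade1 f => exact gen f
  | mul x y hx hy => rw [map_mul]; exact mul _ _ hx hy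
  | add x y hx hy => rw [map_add]; exact add _ _ hx hy

/-- The involution as a morphism of `𝒞₀(𝒦, Γ)` into its conjugate opposite algebra,
`B(f) ↦ B(Γf)`. -/
noncomputable def starHom : Alg Γ →ₐ[ℂ] ConjOp (Alg Γ) :=
  RingQuot.liftAlgHom ℂ (s := Rel Γ)
    ⟨FreeAlgebra.lift ℂ fun f => ConjOp.mk (B₀ Γ (Γ.toMap f)), by
      intro x y h
      induction h with
      | add f g =>
        simp only [map_add, FreeAlgebra.lift_ι_apply, B₀_add, ConjOp.mk_add]
      | smul c f =>
        simp only [map_smul, FreeAlgebra.lift_ι_apply, map_smulₛₗ, B₀_smul, ConjOp.mk_smul,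
          Complex.conj_conj]
      | anticomm f g =>
        simp only [map_add, map_mul, FreeAlgebra.lift_ι_apply, Γ.involutive, AlgHom.commutes]
        rw [← ConjOp.mk_mul, ← ConjOp.mk_mul, ← ConjOp.mk_add, B₀_anticomm,
          ← ConjOp.mk_un (algebraMap ℂ (ConjOp (Alg Γ)) (inner ℂ f g)), ConjOp.un_algebraMap,
          inner_conj_symm]⟩

theorem starHom_B₀ (f : 𝒦) : starHom Γ (B₀ Γ f) = ConjOp.mk (B₀ Γ (Γ.toMap f)) := by
  unfold starHom B₀ quot
  exact (RingQuot.liftAlgHom_mkAlgHom_apply ℂ _ _ _).trans (FreeAlgebra.lift_ι_apply _ _)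

/-- The `*`-structure of `𝒞₀(𝒦, Γ)`, determined by `B(f)* = B(Γf)`. -/
noncomputable instance algStarRing : StarRing (Alg Γ) where
  star a := ConjOp.un (starHom Γ a)
  star_involutive := by
    intro a
    change ConjOp.un (starHom Γ (ConjOp.un (starHom Γ a))) = a
    induction a using alg_induction with
    | scalar c =>
      rw [AlgHom.commutes, ConjOp.un_algebraMap, AlgHom.commutes, ConjOp.un_algebraMap,
        Complex.conj_conj]
    | gen f => rw [starHom_B₀, ConjOp.un_mk, starHom_B₀, ConjOp.un_mk, Γ.involutive]
    | mul a b ha hb => rw [map_mul, ConjOp.un_mul, map_mul, ConjOp.un_mul, ha, hb]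
    | add a b ha hb => rw [map_add, ConjOp.un_add, map_add, ConjOp.un_add, ha, hb]
  star_mul a b := by
    change ConjOp.un (starHom Γ (a * b)) = _
    rw [map_mul, ConjOp.un_mul]
  star_add a b := by
    change ConjOp.un (starHom Γ (a + b)) = _
    rw [map_add, ConjOp.un_add]

theorem star_B₀ (f : 𝒦) : star (B₀ Γ f) = B₀ Γ (Γ.toMap f) := by
  change ConjOp.un (starHom Γ (B₀ Γ f)) = _
  rw [starHom_B₀, ConjOp.un_mk]

theorem star_algebraMap (c : ℂ) :
    star (algebraMap ℂ (Alg Γ) c) = algebraMap ℂ (Alg Γ) (starRingEnd ℂ c) := by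
  change ConjOp.un (starHom Γ (algebraMap ℂ (Alg Γ) c)) = _
  rw [AlgHom.commutes, ConjOp.un_algebraMap]

instance algStarModule : StarModule ℂ (Alg Γ) where
  star_smul c a := by
    rw [Algebra.smul_def, star_mul, star_algebraMap, ← Algebra.commutes, ← Algebra.smul_def]
    rfl

/-- A C*-seminorm on a `*`-algebra. -/
structure IsCStarSeminorm {A : Type*} [Ring A] [Algebra ℂ A] [StarRing A]
    (p : Seminorm ℂ A) : Prop where
  mul_le : ∀ a b, p (a * b) ≤ p a * p b
  star_mul_self : ∀ a, p (star a * a) = p a ^ 2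

theorem IsCStarSeminorm.star_le {A : Type*} [Ring A] [Algebra ℂ A] [StarRing A]
    {p : Seminorm ℂ A} (hp : IsCStarSeminorm p) (a : A) : p (star a) ≤ p a := by
  have h1 := hp.star_mul_self (star a)
  rw [star_star] at h1
  have h2 := hp.mul_le a (star a)
  have h3 := apply_nonneg p a
  have h4 := apply_nonneg p (star a)
  by_contra! h
  nlinarith

theorem IsCStarSeminorm.one_le {A : Type*} [Ring A] [Algebra ℂ A] [StarRing A]
    {p : Seminorm ℂ A} (hp : IsCStarSeminorm p) : p 1 ≤ 1 := by
  have h1 := hp.star_mul_self 1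
  rw [star_one, one_mul] at h1
  have h3 := apply_nonneg p (1 : A)
  by_contra! h
  nlinarith

/-- The set of C*-seminorms on `𝒞₀(𝒦, Γ)` is bounded at every element. -/
theorem exists_bound (a : Alg Γ) :
    ∃ C : ℝ, 0 ≤ C ∧ ∀ p : Seminorm ℂ (Alg Γ), IsCStarSeminorm p → p a ≤ C := by
  have hsc : ∀ (c : ℂ) (p : Seminorm ℂ (Alg Γ)), IsCStarSeminorm p →
      p (algebraMap ℂ (Alg Γ) c) ≤ ‖c‖ := by
    intro c p hp
    rw [Algebra.algebraMap_eq_smul_one, map_smul_eq_mul]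
    have := hp.one_le
    nlinarith [norm_nonneg c]
  induction a using alg_induction with
  | scalar c => exact ⟨‖c‖, norm_nonneg c, hsc c⟩
  | mul a b ha hb =>
    obtain ⟨C, hC, h⟩ := ha
    obtain ⟨D, hD, h'⟩ := hb
    refine ⟨C * D, mul_nonneg hC hD, fun p hp => (hp.mul_le a b).trans ?_⟩
    exact mul_le_mul (h p hp) (h' p hp) (apply_nonneg p b) hC
  | add a b ha hb =>
    obtain ⟨C, hC, h⟩ := ha
    obtain ⟨D, hD, h'⟩ := hb
    exact ⟨C + D, add_nonneg hC hD, fun p hp =>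
      (map_add_le_add p a b).trans (add_le_add (h p hp) (h' p hp))⟩
  | gen f =>
    set c : ℂ := inner ℂ f f with hc
    set r : ℂ := (1 / 2 : ℂ) * inner ℂ (Γ.toMap f) f with hr
    set s : ℂ := (1 / 2 : ℂ) * inner ℂ f (Γ.toMap f) with hs
    have hbb : B₀ Γ f * B₀ Γ f = algebraMap ℂ _ r := by
      have h := B₀_anticomm Γ (Γ.toMap f) f
      rw [Γ.involutive, ← two_smul ℂ] at h
      rw [hr, map_mul, ← h, ← Algebra.smul_def, smul_smul]
      norm_num
    have hss : B₀ Γ (Γ.toMap f) * B₀ Γ (Γ.toMap f) = algebraMap ℂ _ s := by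
      have h := B₀_anticomm Γ f (Γ.toMap f)
      rw [← two_smul ℂ] at h
      rw [hs, map_mul, ← h, ← Algebra.smul_def, smul_smul]
      norm_num
    have hbs : B₀ Γ f * B₀ Γ (Γ.toMap f)
        = algebraMap ℂ _ c - B₀ Γ (Γ.toMap f) * B₀ Γ f := by
      rw [hc, ← B₀_anticomm Γ f f]; abel
    have key : (B₀ Γ (Γ.toMap f) * B₀ Γ f) * (B₀ Γ (Γ.toMap f) * B₀ Γ f)
        = c • (B₀ Γ (Γ.toMap f) * B₀ Γ f) - algebraMap ℂ _ (s * r) := by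
      calc (B₀ Γ (Γ.toMap f) * B₀ Γ f) * (B₀ Γ (Γ.toMap f) * B₀ Γ f)
          = B₀ Γ (Γ.toMap f) * (B₀ Γ f * B₀ Γ (Γ.toMap f)) * B₀ Γ f := by simp only [mul_assoc]
        _ = B₀ Γ (Γ.toMap f) * algebraMap ℂ _ c * B₀ Γ f
            - (B₀ Γ (Γ.toMap f) * B₀ Γ (Γ.toMap f)) * (B₀ Γ f * B₀ Γ f) := by
            rw [hbs]; noncomm_ring
        _ = _ := by
            rw [hbb, hss, ← Algebra.commutes, Algebra.smul_def, map_mul (algebraMap ℂ (Alg Γ)) s r,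
              mul_assoc]
    refine ⟨‖c‖ + ‖s * r‖ + 1, by positivity, fun p hp => ?_⟩
    have e1 := hp.star_mul_self (B₀ Γ f)
    have e2 := hp.star_mul_self (star (B₀ Γ f) * B₀ Γ f)
    rw [star_mul, star_star, star_B₀, key] at e2
    rw [star_B₀] at e1
    have e3 : p (c • (B₀ Γ (Γ.toMap f) * B₀ Γ f) - algebraMap ℂ _ (s * r))
        ≤ ‖c‖ * p (B₀ Γ (Γ.toMap f) * B₀ Γ f) + ‖s * r‖ := by
      refine (map_sub_le_add p _ _).trans (add_le_add (map_smul_eq_mul p _ _).le (hsc _ p hp))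
    rw [e2] at e3
    set t := p (B₀ Γ (Γ.toMap f) * B₀ Γ f) with ht
    have n1 := norm_nonneg c
    have n2 := norm_nonneg (s * r)
    have hpf := apply_nonneg p (B₀ Γ f)
    have h1 : t ≤ ‖c‖ + ‖s * r‖ + 1 := by
      by_contra! h
      nlinarith
    by_contra! h
    nlinarith

/-- The C*-norm of `𝒞₀(𝒦, Γ)`, as the supremum of all C*-seminorms. (A supremum of C*-seminorms is
a C*-seminorm, so that this is the unique C*-norm of `𝒞₀(𝒦, Γ)`.) -/
noncomputable def normFun (a : Alg Γ) : ℝ :=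
  ⨆ p : {p : Seminorm ℂ (Alg Γ) // IsCStarSeminorm p}, p.1 a

theorem isCStarSeminorm_zero : IsCStarSeminorm (0 : Seminorm ℂ (Alg Γ)) :=
  ⟨fun a b => by simp, fun a => by simp⟩

instance : Nonempty {p : Seminorm ℂ (Alg Γ) // IsCStarSeminorm p} :=
  ⟨⟨0, isCStarSeminorm_zero Γ⟩⟩

theorem le_normFun {p : Seminorm ℂ (Alg Γ)} (hp : IsCStarSeminorm p) (a : Alg Γ) :
    p a ≤ normFun Γ a := by
  obtain ⟨C, -, hC⟩ := exists_bound Γ a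
  refine le_ciSup (f := fun p : {p : Seminorm ℂ (Alg Γ) // IsCStarSeminorm p} => p.1 a)
    ⟨C, ?_⟩ ⟨p, hp⟩
  rintro _ ⟨q, rfl⟩
  exact hC q.1 q.2

theorem normFun_nonneg (a : Alg Γ) : 0 ≤ normFun Γ a :=
  le_normFun Γ (isCStarSeminorm_zero Γ) a

noncomputable instance algSeminormedRing : SeminormedRing (Alg Γ) :=
  RingSeminorm.toSeminormedRing
    { toFun := normFun Γ
      map_zero' := by simp [normFun]
      add_le' := fun a b => ciSup_le fun p => (map_add_le_add p.1 a b).trans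
        (add_le_add (le_normFun Γ p.2 a) (le_normFun Γ p.2 b))
      neg' := fun a => by simp [normFun]
      mul_le' := fun a b => ciSup_le fun p => (p.2.mul_le a b).trans
        (mul_le_mul (le_normFun Γ p.2 a) (le_normFun Γ p.2 b) (apply_nonneg p.1 b)
          (normFun_nonneg Γ a)) }

theorem norm_def (a : Alg Γ) : ‖a‖ = normFun Γ a := rfl

noncomputable instance algNormedAlgebra : NormedAlgebra ℂ (Alg Γ) where
  norm_smul_le c a := by
    rw [norm_def, norm_def]
    refine ciSup_le fun p => ?_
    rw [map_smul_eq_mul]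
    exact mul_le_mul_of_nonneg_left (le_normFun Γ p.2 a) (norm_nonneg c)

instance algNormedStarGroup : NormedStarGroup (Alg Γ) where
  norm_star_le a := ciSup_le fun p => (p.2.star_le a).trans (le_normFun Γ p.2 a)

theorem norm_mul_self_le_alg (a : Alg Γ) : ‖a‖ * ‖a‖ ≤ ‖star a * a‖ := by
  rw [norm_def, norm_def, ← Real.sqrt_le_sqrt_iff (normFun_nonneg Γ _),
    Real.sqrt_mul_self (normFun_nonneg Γ a)]
  refine ciSup_le fun p => Real.le_sqrt_of_sq_le ?_
  rw [← p.2.star_mul_self]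
  exact le_normFun Γ p.2 _

/-- The CAR algebra `𝒞(𝒦, Γ)`: the C*-completion of `𝒞₀(𝒦, Γ)`. -/
def CStar (Γ : AntiunitaryInvolution 𝒦) : Type _ := UniformSpace.Completion (Alg Γ)

noncomputable instance cstarNormedRing : NormedRing (CStar Γ) :=
  inferInstanceAs (NormedRing (UniformSpace.Completion (Alg Γ)))

noncomputable instance cstarAlgebra : Algebra ℂ (CStar Γ) :=
  inferInstanceAs (Algebra ℂ (UniformSpace.Completion (Alg Γ)))

noncomputable instance cstarNormedAlgebra : NormedAlgebra ℂ (CStar Γ) where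
  norm_smul_le c a := norm_smul_le (α := ℂ) (β := UniformSpace.Completion (Alg Γ)) c a

instance cstarComplete : CompleteSpace (CStar Γ) :=
  inferInstanceAs (CompleteSpace (UniformSpace.Completion (Alg Γ)))

/-- The canonical morphism `𝒞₀(𝒦, Γ) → 𝒞(𝒦, Γ)`. -/
noncomputable def toCStar : Alg Γ →ₐ[ℂ] CStar Γ where
  toFun a := (a : UniformSpace.Completion (Alg Γ))
  map_one' := UniformSpace.Completion.coe_one _
  map_mul' := UniformSpace.Completion.coe_mul
  map_zero' := UniformSpace.Completion.coe_zero
  map_add' := UniformSpace.Completion.coe_add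
  commutes' _ := rfl

theorem norm_toCStar (a : Alg Γ) : ‖toCStar Γ a‖ = ‖a‖ :=
  UniformSpace.Completion.norm_coe a

theorem denseRange_toCStar : DenseRange (toCStar Γ) :=
  UniformSpace.Completion.denseRange_coe (α := Alg Γ)

theorem uniformContinuous_star : UniformContinuous (star : Alg Γ → Alg Γ) :=
  (starₗᵢ (E := Alg Γ) ℂ).isometry.uniformContinuous

/-- The `*`-operation of `𝒞(𝒦, Γ)`, by continuous extension. -/
noncomputable def cstarStar : CStar Γ → CStar Γ :=
  UniformSpace.Completion.map (star : Alg Γ → Alg Γ)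

theorem continuous_cstarStar : Continuous (cstarStar Γ) :=
  UniformSpace.Completion.continuous_map

theorem cstarStar_toCStar (a : Alg Γ) : cstarStar Γ (toCStar Γ a) = toCStar Γ (star a) :=
  UniformSpace.Completion.map_coe (uniformContinuous_star Γ) a

noncomputable instance cstarStarRing : StarRing (CStar Γ) where
  star := cstarStar Γ
  star_involutive a := by
    refine (denseRange_toCStar Γ).induction_on (p := fun a => cstarStar Γ (cstarStar Γ a) = a) a
      (isClosed_eq ((continuous_cstarStar Γ).comp (continuous_cstarStar Γ)) continuous_id) ?_
    intro x
    rw [cstarStar_toCStar, cstarStar_toCStar, star_star]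
  star_mul a b := by
    refine (denseRange_toCStar Γ).induction_on₂
      (p := fun a b => cstarStar Γ (a * b) = cstarStar Γ b * cstarStar Γ a) ?_ ?_ a b
    · exact isClosed_eq ((continuous_cstarStar Γ).comp continuous_mul)
        (((continuous_cstarStar Γ).comp continuous_snd).mul
          ((continuous_cstarStar Γ).comp continuous_fst))
    · intro x y
      rw [← map_mul, cstarStar_toCStar, cstarStar_toCStar, cstarStar_toCStar, star_mul, map_mul]
  star_add a b := by
    refine (denseRange_toCStar Γ).induction_on₂
      (p := fun a b => cstarStar Γ (a + b) = cstarStar Γ a + cstarStar Γ b) ?_ ?_ a b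
    · exact isClosed_eq ((continuous_cstarStar Γ).comp continuous_add)
        (((continuous_cstarStar Γ).comp continuous_fst).add
          ((continuous_cstarStar Γ).comp continuous_snd))
    · intro x y
      rw [← map_add, cstarStar_toCStar, cstarStar_toCStar, cstarStar_toCStar, star_add, map_add]

theorem star_toCStar (a : Alg Γ) : star (toCStar Γ a) = toCStar Γ (star a) :=
  cstarStar_toCStar Γ a

noncomputable instance cstarCStarAlgebra : CStarAlgebra (CStar Γ) where
  norm_mul_self_le a := by
    refine (denseRange_toCStar Γ).induction_on
      (p := fun a => ‖a‖ * ‖a‖ ≤ ‖cstarStar Γ a * a‖) a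
      (isClosed_le (continuous_norm.mul continuous_norm)
        ((continuous_cstarStar Γ).mul continuous_id).norm) ?_
    intro x
    rw [cstarStar_toCStar, ← map_mul, norm_toCStar, norm_toCStar]
    exact norm_mul_self_le_alg Γ x
  star_smul c a := by
    refine (denseRange_toCStar Γ).induction_on
      (p := fun a => cstarStar Γ (c • a) = star c • cstarStar Γ a) a
      (isClosed_eq ((continuous_cstarStar Γ).comp (continuous_const_smul c))
        ((continuous_cstarStar Γ).const_smul (star c))) ?_
    intro x
    rw [← map_smul, cstarStar_toCStar, cstarStar_toCStar, star_smul, map_smul]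

/-- The generators `B(f)` of `𝒞(𝒦, Γ)`. -/
noncomputable def B (f : 𝒦) : CStar Γ := toCStar Γ (B₀ Γ f)

/-- A state on `𝒞(𝒦, Γ)`: a positive linear functional of norm one. -/
structure IsState (φ : CStar Γ →L[ℂ] ℂ) : Prop where
  nonneg : ∀ a, 0 ≤ φ (star a * a)
  norm_eq_one : ‖φ‖ = 1

/-- A quasi-free state on `𝒞(𝒦, Γ)`: the moments are given by Wick's formula. The positions
`1, …, 2n` are `Fin (n + n)`; `Fin.castAdd n i` is the position `i` and `Fin.natAdd n i` the
position `n + i`. -/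
structure IsQuasiFree (φ : CStar Γ →L[ℂ] ℂ) : Prop where
  isState : IsState Γ φ
  odd : ∀ (n : ℕ) (f : Fin (2 * n + 1) → 𝒦), φ (List.ofFn fun i => B Γ (f i)).prod = 0
  even : ∀ (n : ℕ) (f : Fin (n + n) → 𝒦),
    open scoped Classical in
    φ (List.ofFn fun i => B Γ (f i)).prod =
      (-1) ^ (n * (n - 1) / 2) *
        ∑ σ : Equiv.Perm (Fin (n + n)) with
            (StrictMono fun i : Fin n => σ (Fin.castAdd n i)) ∧
              ∀ i : Fin n, σ (Fin.castAdd n i) < σ (Fin.natAdd n i),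
          ((Equiv.Perm.sign σ : ℤ) : ℂ) *
            ∏ i : Fin n, φ (B Γ (f (σ (Fin.castAdd n i))) * B Γ (f (σ (Fin.natAdd n i))))

end CAR

/-! ## The doubled one-particle space over `ℓ²(X)` -/

section Lattice

/-- The Hilbert space `ℓ²(X)`. -/
abbrev EllTwo (X : Type*) : Type _ := lp (fun _ : X => ℂ) 2

variable (X : Type*)

/-- The doubled one-particle space `𝒦 = ℓ²(X) ⊕ ℓ²(X)`. -/
abbrev Doubled : Type _ := WithLp 2 (EllTwo X × EllTwo X)

/-- `Γ(u, v) = (Jv, Ju)` on `ℓ²(X) ⊕ ℓ²(X)`, where `J = star` is the complex conjugation. -/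
noncomputable def doubledInvolution : AntiunitaryInvolution (Doubled X) where
  toMap :=
    { toFun := fun f => WithLp.toLp 2 (star f.snd, star f.fst)
      map_add' := fun f g => by
        simp only [WithLp.add_fst, WithLp.add_snd, star_add]
        rfl
      map_smul' := fun c f => by
        simp only [WithLp.smul_fst, WithLp.smul_snd, star_smul]
        rfl }
  involutive f := by
    change WithLp.toLp 2 (star (star f.fst), star (star f.snd)) = f
    rw [star_star, star_star]
    rfl
  inner_map f g := by
    have h : ∀ u v : EllTwo X, inner ℂ (star u) (star v) = (inner ℂ v u : ℂ) := by
      intro u v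
      rw [lp.inner_eq_tsum, lp.inner_eq_tsum]
      refine tsum_congr fun x => ?_
      simp [mul_comm]
    change inner ℂ (WithLp.toLp 2 (star f.snd, star f.fst))
      (WithLp.toLp 2 (star g.snd, star g.fst)) = _
    rw [WithLp.prod_inner_apply, WithLp.prod_inner_apply]
    change inner ℂ (star f.snd) (star g.snd) + inner ℂ (star f.fst) (star g.fst)
      = inner ℂ g.fst f.fst + inner ℂ g.snd f.snd
    rw [h, h, add_comm]

/-- The CAR algebra `𝒞(𝒦, Γ)` over the doubled space. -/
abbrev CARAlgebra : Type _ := CAR.CStar (doubledInvolution X)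

variable {X}

/-- The vector `e_x` of the standard orthonormal basis of `ℓ²(X)`. -/
noncomputable def basisVec (x : X) : EllTwo X :=
  open scoped Classical in lp.single 2 x (1 : ℂ)

/-- The annihilation operator `a_x = B((0, e_x))`. -/
noncomputable def annih (x : X) : CARAlgebra X :=
  CAR.B (doubledInvolution X) (WithLp.toLp 2 (0, basisVec x))

variable (X) in
/-- The gauge-invariant subalgebra `𝒜(𝒦, Γ)`: the closed `*`-subalgebra of `𝒞(𝒦, Γ)`
generated by all `a_x* a_y`. -/
noncomputable def GaugeInvariant : StarSubalgebra ℂ (CARAlgebra X) :=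
  (StarAlgebra.adjoin ℂ
    {A : CARAlgebra X | ∃ x y : X, A = star (annih x) * annih y}).topologicalClosure

/-- `a_x* a_y` as an element of `𝒜(𝒦, Γ)`. -/
noncomputable def hop (x y : X) : GaugeInvariant X :=
  ⟨star (annih x) * annih y,
    StarSubalgebra.le_topologicalClosure _ (StarAlgebra.subset_adjoin ℂ _ ⟨x, y, rfl⟩)⟩

/-- `η_x = 1 - 2 a_x* a_x`. -/
noncomputable def eta (x : X) : GaugeInvariant X := 1 - (2 : ℂ) • hop x x

/-- `η_(x,y)`, the product of the (commuting) `η_z` over `x < z < y`. -/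
noncomputable def etaBetween [LinearOrder X] [LocallyFiniteOrder X] (x y : X) :
    GaugeInvariant X :=
  (((Finset.Ioo x y).sort).map eta).prod

/-- The element of `𝒜(𝒦, Γ)` representing the transposition of `x < y`,
`(1 + η_x η_y) / 2 + (1 + η_x η_y + (1 - η_x η_y) η_(x,y)) / 2 * (a_x* a_y + a_y* a_x)`. -/
noncomputable def swapElt [LinearOrder X] [LocallyFiniteOrder X] (x y : X) : GaugeInvariant X :=
  (1 / 2 : ℂ) • (1 + eta x * eta y)
    + ((1 / 2 : ℂ) • (1 + eta x * eta y + (1 - eta x * eta y) * etaBetween x y))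
      * (hop x y + hop y x)

/-! ## Point processes and perfectness -/

open MeasureTheory

/-- Point configurations in `X`: the space `{0,1}^X` (`true` means occupied), with the
product `σ`-algebra. -/
abbrev Config (X : Type*) : Type _ := X → Bool

/-- `M` is the determinantal point process with correlation kernel `K`: for distinct points
`x₁, …, xₙ` the probability that all of them are occupied is `det [K(x_i, x_j)]`. -/
def IsDPP (M : Measure (Config X)) (K : X → X → ℂ) : Prop :=
  IsProbabilityMeasure M ∧
    ∀ (n : ℕ) (x : Fin n → X), Function.Injective x →
      ((M.real {ω | ∀ i, ω (x i) = true} : ℝ) : ℂ)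
        = (Matrix.of fun i j => K (x i) (x j)).det

/-- The action of a permutation on configurations: `g(ω) = {g(x) : x ∈ ω}`. -/
def permute (g : Equiv.Perm X) (ω : Config X) : Config X := fun x => ω (g⁻¹ x)

/-- Quasi-invariance under the group of finite permutations of `X`. -/
def IsQuasiInvariant (M : Measure (Config X)) : Prop :=
  ∀ g : Equiv.Perm X, {x | g x ≠ x}.Finite →
    M ≪ M.map (permute g) ∧ M.map (permute g) ≪ M

variable [LinearOrder X] [LocallyFiniteOrder X]

/-- `T` is the representation `𝒯^M` of `𝒜(𝒦, Γ)` on `L²(Ω, M)`: `η_x` acts as multiplication by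
`1 - 2 ω(x)`, and the element representing the transposition `s` of `x < y` acts as the Koopman
operator `h ↦ h(s⁻¹ ω) (d(ˢM)/dM (ω))^{1/2}`. These elements generate `𝒜(𝒦, Γ)` topologically,
so there is at most one such `T`. -/
structure IsKoopmanRep (M : Measure (Config X))
    (T : GaugeInvariant X →⋆ₐ[ℂ] (Lp ℂ 2 M →L[ℂ] Lp ℂ 2 M)) : Prop where
  eta_apply : ∀ (x : X) (h : Lp ℂ 2 M),
    T (eta x) h =ᵐ[M] fun ω => (if ω x = true then -1 else 1) * h ω
  swap_apply : ∀ (x y : X), x < y → ∀ h : Lp ℂ 2 M,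
    T (swapElt x y) h =ᵐ[M] fun ω =>
      h (permute (Equiv.swap x y)⁻¹ ω) *
        ((Real.sqrt (((M.map (permute (Equiv.swap x y))).rnDeriv M ω).toReal) : ℝ) : ℂ)

/-- Perfectness of a probability measure `M`: it is quasi-invariant, and the state
`φ^M(A) = (1, 𝒯^M(A) 1)` on `𝒜(𝒦, Γ)` is the restriction of a quasi-free state on `𝒞(𝒦, Γ)`. -/
def IsPerfect (M : Measure (Config X)) [IsProbabilityMeasure M] : Prop :=
  IsQuasiInvariant M ∧
    ∃ T : GaugeInvariant X →⋆ₐ[ℂ] (Lp ℂ 2 M →L[ℂ] Lp ℂ 2 M), IsKoopmanRep M T ∧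
      ∃ φ : CARAlgebra X →L[ℂ] ℂ, CAR.IsQuasiFree (doubledInvolution X) φ ∧
        ∀ A : GaugeInvariant X,
          φ (A : CARAlgebra X) = inner ℂ (Lp.const 2 M (1 : ℂ)) (T A (Lp.const 2 M (1 : ℂ)))

end Lattice

/-- The kernel `K(x, y) = (e_x, K e_y)` of the orthogonal projection `K` of `ℓ²(X)` onto the span
of `v₁, …, v_N`. -/
noncomputable def spanKernel {X : Type*} {N : ℕ} (v : Fin N → EllTwo X) (x y : X) : ℂ :=
  have : FiniteDimensional ℂ (Submodule.span ℂ (Set.range v)) :=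
    FiniteDimensional.span_of_finite ℂ (Set.finite_range v)
  inner ℂ (basisVec x) ((Submodule.span ℂ (Set.range v)).starProjection (basisVec y))

/-- The sign condition `det (v_i(x_j)) ≥ 0` (real and non-negative) for all `x₁ > ⋯ > x_N`. -/
def NonnegMinors {X : Type*} [LinearOrder X] {N : ℕ} (v : Fin N → EllTwo X) : Prop :=
  ∀ x : Fin N → X, StrictAnti x → 0 ≤ (Matrix.of fun i j => v i (x j)).det

/-! ## Wick's formula from the recursion in the first argument -/

/-! The measure is the law of a Slater determinant, seen in the basis of finite subsets. On the
fermionic Fock space `Fock X`, with creators `a*(u)` defined through Jordan–Wigner signs, let `ψ` be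
the normalised vector `a*(v₁) ⋯ a*(v_N) Ω`. The signs count occupied points to the right, so the
amplitude at `{x₁ > ⋯ > x_N}` is, up to the positive normalisation, exactly `det (v_i(x_j))`
(`slater_apply_image`). Hence the hypothesis on minors says `ψ(S) ≥ 0`, that is, `ψ` is the square
root of the law `M(S) = |ψ(S)|²`.

With `P` the projection onto the span of the `v_i`, both `a*(P u)` and `a(u - P u)` annihilate `ψ`
for every `u`. These relations do two things. Moving annihilating operators to the right gives
determinantal correlations (`inner_createProd_star_createProd`), so `M` is the DPP with kernel `P`.
The same manoeuvre on general field operators gives the Pfaffian recursion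
(`IsPolarized.expansion`), whose iteration is Wick's formula (`wick_of_recursion`); so the vector
state of `ψ` is quasi-free. Uniqueness of the DPP holds because the events "all points of `F` are
occupied" form a generating π-system.

For perfectness, `h ↦ ψ h` is an isometry of `L²(M)` into the Fock space taking `1` to `ψ`.
Quasi-invariance makes `ψ` nonzero on every `N`-element set, so the range is the whole `N`-particle
sector, which the gauge-invariant algebra preserves. The element attached to a transposition `s` is
built so that `η_(x,y)` cancels the Jordan–Wigner sign of the hop: it acts as `ψ(S) ↦ ψ(s S)` with
no sign (`gaugeRep_swapElt_apply`). Pulled back to `L²(M)` it carries the weight `ψ(s S) / ψ(S)`,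
and since `ψ ≥ 0` this is the square root of the Radon–Nikodym derivative, as the Koopman operator
requires.

For orthogonal polynomial ensembles the minors are Vandermonde determinants times positive weights.
They are strictly positive, so every `N`-element set is an atom and quasi-invariance is automatic.
-/

section Wick

open Equiv

/-- The permutation of `Fin (k + 1)` that sends `a` to `b` and acts as `σ` on the other points,
numbered increasingly. -/
def permInsert {k : ℕ} (a b : Fin (k + 1)) (σ : Perm (Fin k)) : Perm (Fin (k + 1)) :=
  (a.cycleRange.trans (Perm.decomposeFin.symm (0, σ))).trans b.cycleRange.symm

theorem permInsert_self {k : ℕ} (a b : Fin (k + 1)) (σ : Perm (Fin k)) :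
    permInsert a b σ a = b := by
  simp [permInsert]

theorem permInsert_succAbove {k : ℕ} (a b : Fin (k + 1)) (σ : Perm (Fin k)) (i : Fin k) :
    permInsert a b σ (a.succAbove i) = b.succAbove (σ i) := by
  simp [permInsert]

/-- The two cycles that bring `a` and `b` to position `0` have signs `(-1)^a` and `(-1)^b`. -/
theorem sign_permInsert {k : ℕ} (a b : Fin (k + 1)) (σ : Perm (Fin k)) :
    Perm.sign (permInsert a b σ) = (-1) ^ ((a : ℕ) + b) * Perm.sign σ := by
  rw [permInsert, Perm.sign_trans, Perm.sign_trans, Perm.sign_symm, Fin.sign_cycleRange,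
    Fin.sign_cycleRange, Perm.decomposeFin.symm_sign, if_pos rfl, one_mul, pow_add]
  ac_rfl

theorem exists_eq_permInsert {k : ℕ} (a b : Fin (k + 1)) (σ : Perm (Fin (k + 1)))
    (h : σ a = b) : ∃ τ, σ = permInsert a b τ := by
  obtain ⟨⟨p, τ⟩, hτ⟩ := Perm.decomposeFin.symm.surjective
    ((a.cycleRange.symm.trans σ).trans b.cycleRange)
  have hp : p = 0 := by
    have := congrArg (fun e => e 0) hτ
    simpa [h] using this
  subst hp
  refine ⟨τ, ?_⟩
  rw [permInsert, hτ]
  ext x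
  simp

theorem permInsert_injective {k : ℕ} (a b : Fin (k + 1)) :
    Function.Injective (permInsert a b) := by
  intro σ τ h
  ext i
  have := congrArg (fun e => e (a.succAbove i)) h
  simp only [permInsert_succAbove] at this
  rw [Fin.succAbove_right_injective this]

/-- The first half of the positions `0, …, m - 1`, where `m = n + n`. -/
def leftPos {m n : ℕ} (h : m = n + n) (i : Fin n) : Fin m := ⟨i, by omega⟩

/-- The second half of the positions `0, …, m - 1`, where `m = n + n`. -/
def rightPos {m n : ℕ} (h : m = n + n) (i : Fin n) : Fin m := ⟨n + i, by omega⟩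

/-- The pairings of `0, …, m - 1`, as permutations. -/
def IsPairing {m n : ℕ} (h : m = n + n) (σ : Perm (Fin m)) : Prop :=
  (StrictMono fun i : Fin n => σ (leftPos h i)) ∧
    ∀ i : Fin n, σ (leftPos h i) < σ (rightPos h i)

theorem add_two_eq {m n : ℕ} (h : m = n + n) : m + 2 = n + 1 + (n + 1) := by omega

/-- The permutation of `Fin (m + 2)` fixing `0`, sending `n + 1` to `j + 1` and acting as `σ`
on the other points. -/
def pairInsert {m : ℕ} (n : Fin (m + 1)) (j : Fin (m + 1)) (σ : Perm (Fin m)) :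
    Perm (Fin (m + 2)) :=
  permInsert 0 0 (permInsert n j σ)

theorem pairInsert_zero {m : ℕ} (n j : Fin (m + 1)) (σ : Perm (Fin m)) :
    pairInsert n j σ 0 = 0 := permInsert_self _ _ _

theorem pairInsert_succ {m : ℕ} (n j : Fin (m + 1)) (σ : Perm (Fin m)) (i : Fin (m + 1)) :
    pairInsert n j σ i.succ = (permInsert n j σ i).succ := by
  have := permInsert_succAbove 0 0 (permInsert n j σ) i
  rwa [Fin.zero_succAbove, Fin.zero_succAbove] at this

theorem sign_pairInsert {m : ℕ} (n j : Fin (m + 1)) (σ : Perm (Fin m)) :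
    Perm.sign (pairInsert n j σ) = (-1) ^ ((n : ℕ) + j) * Perm.sign σ := by
  rw [pairInsert, sign_permInsert, sign_permInsert]
  simp

variable {m n : ℕ} (h : m = n + n)

theorem leftPos_succ (i : Fin n) :
    leftPos (m := m + 2) (n := n + 1) (add_two_eq h) i.succ
      = (Fin.succAbove (⟨n, by omega⟩ : Fin (m + 1)) (leftPos h i)).succ := by
  rw [Fin.succAbove_of_castSucc_lt _ _ (by simp [Fin.lt_def, leftPos])]
  ext; simp [leftPos]

theorem rightPos_succ (i : Fin n) :
    rightPos (m := m + 2) (n := n + 1) (add_two_eq h) i.succ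
      = (Fin.succAbove (⟨n, by omega⟩ : Fin (m + 1)) (rightPos h i)).succ := by
  rw [Fin.succAbove_of_le_castSucc _ _ (by simp [Fin.le_def, rightPos])]
  ext; simp [rightPos]; omega

theorem leftPos_zero :
    leftPos (m := m + 2) (n := n + 1) (add_two_eq h) 0 = 0 := by
  ext; simp [leftPos]

theorem rightPos_zero :
    rightPos (m := m + 2) (n := n + 1) (add_two_eq h) 0 = (⟨n, by omega⟩ : Fin (m + 1)).succ := by
  ext; simp [rightPos]

theorem pairInsert_leftPos (j : Fin (m + 1)) (σ : Perm (Fin m)) (i : Fin n) :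
    pairInsert ⟨n, by omega⟩ j σ (leftPos (m := m + 2) (n := n + 1) (add_two_eq h) i.succ)
      = (j.succAbove (σ (leftPos h i))).succ := by
  rw [leftPos_succ h, pairInsert_succ, permInsert_succAbove]

theorem pairInsert_rightPos (j : Fin (m + 1)) (σ : Perm (Fin m)) (i : Fin n) :
    pairInsert ⟨n, by omega⟩ j σ (rightPos (m := m + 2) (n := n + 1) (add_two_eq h) i.succ)
      = (j.succAbove (σ (rightPos h i))).succ := by
  rw [rightPos_succ h, pairInsert_succ, permInsert_succAbove]

theorem pairInsert_rightPos_zero (j : Fin (m + 1)) (σ : Perm (Fin m)) :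
    pairInsert ⟨n, by omega⟩ j σ (rightPos (m := m + 2) (n := n + 1) (add_two_eq h) 0) = j.succ := by
  rw [rightPos_zero h, pairInsert_succ, permInsert_self]

/-- All order conditions survive because `succAbove` and `succ` are strictly increasing; the new
pair starts at `0`, the least point, so its partner is unconstrained. -/
theorem isPairing_pairInsert (j : Fin (m + 1)) (σ : Perm (Fin m)) :
    IsPairing (m := m + 2) (n := n + 1) (add_two_eq h) (pairInsert ⟨n, by omega⟩ j σ)
      ↔ IsPairing h σ := by
  constructor
  · rintro ⟨h1, h2⟩
    refine ⟨fun i i' hi => ?_, fun i => ?_⟩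
    · have := h1 (Fin.succ_lt_succ_iff.2 hi)
      simp only [pairInsert_leftPos h, Fin.succ_lt_succ_iff] at this
      exact (Fin.strictMono_succAbove j).lt_iff_lt.1 this
    · have := h2 i.succ
      simp only [pairInsert_leftPos h, pairInsert_rightPos h, Fin.succ_lt_succ_iff] at this
      exact (Fin.strictMono_succAbove j).lt_iff_lt.1 this
  · rintro ⟨h1, h2⟩
    refine ⟨fun i i' hi => ?_, fun i => ?_⟩
    · obtain ⟨i', rfl⟩ := Fin.exists_succ_eq.2 (Fin.ne_zero_of_lt hi)
      induction i using Fin.cases with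
      | zero =>
        simp only [leftPos_zero h, pairInsert_zero, pairInsert_leftPos h]
        exact Fin.succ_pos _
      | succ i =>
        simp only [pairInsert_leftPos h, Fin.succ_lt_succ_iff]
        exact Fin.strictMono_succAbove j (h1 (Fin.succ_lt_succ_iff.1 hi))
    · induction i using Fin.cases with
      | zero =>
        rw [leftPos_zero h, pairInsert_zero, pairInsert_rightPos_zero h]
        exact Fin.succ_pos _
      | succ i =>
        rw [pairInsert_leftPos h, pairInsert_rightPos h, Fin.succ_lt_succ_iff]
        exact Fin.strictMono_succAbove j (h2 i)

include h in
theorem IsPairing.exists_eq_pairInsert {σ : Perm (Fin (m + 2))}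
    (hσ : IsPairing (m := m + 2) (n := n + 1) (add_two_eq h) σ) :
    ∃ j τ, σ = pairInsert ⟨n, by omega⟩ j τ := by
  -- If `σ 0` were positive, every left value would be positive by monotonicity and every right
  -- value would exceed a left one, so the value `0` would not be attained.
  have h0 : σ 0 = 0 := by
    by_contra h0
    have hpos : ∀ i : Fin (n + 1), 0 < σ (leftPos (m := m + 2) (by omega) i) := by
      intro i
      have h1 : σ 0 ≤ σ (leftPos (m := m + 2) (by omega) i) := by
        have := hσ.1.monotone (Fin.zero_le i)
        simpa only [leftPos_zero h] using this
      exact (Fin.pos_iff_ne_zero.2 h0).trans_le h1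
    obtain ⟨a, ha⟩ := σ.surjective 0
    by_cases hlt : (a : ℕ) < n + 1
    · have := hpos ⟨a, hlt⟩
      rw [show leftPos (m := m + 2) (n := n + 1) (add_two_eq h) ⟨a, hlt⟩ = a from rfl, ha] at this
      exact lt_irrefl _ this
    · have := (hpos ⟨a - (n + 1), by omega⟩).trans (hσ.2 ⟨a - (n + 1), by omega⟩)
      rw [show rightPos (m := m + 2) (n := n + 1) (add_two_eq h) ⟨a - (n + 1), by omega⟩ = a by
        ext; simp [rightPos]; omega, ha] at this
      exact lt_irrefl _ this
  obtain ⟨σ', rfl⟩ := exists_eq_permInsert 0 0 σ h0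
  obtain ⟨τ, hτ⟩ := exists_eq_permInsert ⟨n, by omega⟩ _ σ' rfl
  exact ⟨_, τ, congrArg (permInsert 0 0) hτ⟩

/-- A pairing of `m + 2` points amounts to the partner `j + 1` of the point `0` and a pairing of the
remaining `m` points. -/
theorem sum_isPairing_succ {R : Type*} [AddCommMonoid R] (F : Perm (Fin (m + 2)) → R)
    [DecidablePred (IsPairing (m := m + 2) (n := n + 1) (add_two_eq h))]
    [DecidablePred (IsPairing h)] :
    ∑ σ with IsPairing (m := m + 2) (n := n + 1) (add_two_eq h) σ, F σ
      = ∑ j : Fin (m + 1), ∑ τ with IsPairing h τ, F (pairInsert ⟨n, by omega⟩ j τ) := by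
  rw [Finset.sum_sigma']
  symm
  refine Finset.sum_bij (fun p _ => pairInsert ⟨n, by omega⟩ p.1 p.2) ?_ ?_ ?_ ?_
  · rintro ⟨j, τ⟩ hp
    simp only [Finset.mem_sigma, Finset.mem_univ, Finset.mem_filter, true_and] at hp ⊢
    exact (isPairing_pairInsert h j τ).2 hp
  · rintro ⟨j, τ⟩ - ⟨j', τ'⟩ - he
    have hj : j = j' := by
      have := congrArg (fun e => e (rightPos (m := m + 2) (n := n + 1) (add_two_eq h) 0)) he
      simp only [pairInsert_rightPos_zero h] at this
      exact Fin.succ_injective _ this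
    subst hj
    exact congrArg (Sigma.mk j) (permInsert_injective _ _ (permInsert_injective _ _ he))
  · intro σ hσ
    simp only [Finset.mem_univ, Finset.mem_filter, true_and] at hσ
    obtain ⟨j, τ, rfl⟩ := hσ.exists_eq_pairInsert h
    refine ⟨⟨j, τ⟩, ?_, rfl⟩
    simpa using (isPairing_pairInsert h j τ).1 hσ
  · intros; rfl

open scoped Classical in
/-- A family of functions satisfying the expansion of a Pfaffian along the first row is given by
the sum over all pairings. -/
theorem wick_of_recursion {V R : Type*} [CommRing R] (W : ∀ m, (Fin m → V) → R) (w : V → V → R)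
    (h0 : ∀ f, W 0 f = 1)
    (hrec : ∀ m (f : Fin (m + 2) → V), W (m + 2) f = ∑ j : Fin (m + 1),
      (-1) ^ (j : ℕ) * w (f 0) (f j.succ) * W m (fun i => f (j.succAbove i).succ)) :
    ∀ (n m : ℕ) (h : m = n + n) (f : Fin m → V),
      W m f = (-1) ^ (n * (n - 1) / 2) * ∑ σ with IsPairing h σ,
        ((Perm.sign σ : ℤ) : R) * ∏ i : Fin n, w (f (σ (leftPos h i))) (f (σ (rightPos h i))) := by
  intro n
  induction n with
  | zero =>
    intro m h f
    obtain rfl : m = 0 := by omega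
    rw [h0, Finset.filter_true_of_mem (fun σ _ => ⟨fun i => i.elim0, fun i => i.elim0⟩)]
    simp
  | succ n ih =>
    intro m h f
    obtain ⟨m, rfl⟩ : ∃ k, m = k + 2 := ⟨m - 2, by omega⟩
    have h' : m = n + n := by omega
    rw [hrec, sum_isPairing_succ h', Finset.mul_sum]
    refine Finset.sum_congr rfl fun j _ => ?_
    rw [ih m h', Finset.mul_sum, Finset.mul_sum, Finset.mul_sum]
    refine Finset.sum_congr rfl fun τ _ => ?_
    rw [Fin.prod_univ_succ, leftPos_zero h', pairInsert_zero, pairInsert_rightPos_zero h',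
      sign_pairInsert]
    simp only [pairInsert_leftPos h', pairInsert_rightPos h']
    -- Since `n(n+1)/2 = n(n-1)/2 + n`, the prefactor gains `(-1)^n`. It cancels the `(-1)^n` in
    -- `sign_pairInsert`, which leaves the `(-1)^j` of the recursion.
    have hsign : (-1 : R) ^ ((n + 1) * (n + 1 - 1) / 2) = (-1) ^ (n * (n - 1) / 2) * (-1) ^ n := by
      rw [← pow_add]
      congr 1
      rw [← Finset.sum_range_id_mul_two, ← Finset.sum_range_id_mul_two, Finset.sum_range_succ]
      omega
    rw [hsign]
    push_cast
    have : (-1 : R) ^ n * (-1) ^ n = 1 := by rw [← mul_pow]; simp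
    rw [pow_add]
    linear_combination (-(-1 : R) ^ (n * (n - 1) / 2) * (-1) ^ (j : ℕ) * w (f 0) (f j.succ) *
      (((Perm.sign τ : ℤ) : R) * ∏ i : Fin n, w (f (j.succAbove (τ (leftPos h' i))).succ)
        (f (j.succAbove (τ (rightPos h' i))).succ))) * this

/-- Moving an operator `c` through a product of operators with which it anticommutes up to
scalars. -/
theorem mul_prod_ofFn_of_anticomm {R A : Type*} [CommRing R] [Ring A] [Algebra R A] (c : A) :
    ∀ (m : ℕ) (b : Fin (m + 1) → A) (s : Fin (m + 1) → R),
      (∀ i, c * b i + b i * c = algebraMap R A (s i)) →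
      c * (List.ofFn b).prod = (∑ j : Fin (m + 1),
        ((-1) ^ (j : ℕ) * s j) • (List.ofFn fun i => b (j.succAbove i)).prod)
          + (-1) ^ (m + 1) * ((List.ofFn b).prod * c) := by
  intro m
  induction m with
  | zero =>
    intro b s h
    have := h 0
    have e := Fin.sum_univ_one fun j : Fin 1 =>
      ((-1) ^ (j : ℕ) * s j) • (List.ofFn fun i => b (j.succAbove i)).prod
    change c * (List.ofFn (n := 1) b).prod = (∑ j : Fin 1,
      ((-1) ^ (j : ℕ) * s j) • (List.ofFn fun i => b (j.succAbove i)).prod)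
        + (-1) ^ 1 * ((List.ofFn (n := 1) b).prod * c)
    rw [e]
    simp only [List.ofFn_succ, List.ofFn_zero, List.prod_cons, List.prod_nil, Fin.val_zero,
      pow_zero, one_mul, mul_one, pow_one, Algebra.smul_def]
    rw [← this]; noncomm_ring
  | succ m ih =>
    intro b s h
    have h0 := h 0
    have ih' := ih (fun i => b i.succ) (fun i => s i.succ) (fun i => h i.succ)
    rw [List.ofFn_succ, List.prod_cons, Fin.sum_univ_succ]
    -- One anticommutation past `b 0`; the induction hypothesis then carries `c` through the tail.
    have e1 : c * (b 0 * (List.ofFn fun i => b i.succ).prod)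
        = s 0 • (List.ofFn fun i => b i.succ).prod
          - b 0 * (c * (List.ofFn fun i => b i.succ).prod) := by
      rw [Algebra.smul_def, ← h0]; noncomm_ring
    rw [e1, ih']
    have e2 : ∀ j : Fin (m + 1), (List.ofFn fun i => b (j.succ.succAbove i)).prod
        = b 0 * (List.ofFn fun i => b (j.succAbove i).succ).prod := by
      intro j
      rw [List.ofFn_succ, List.prod_cons, Fin.succ_succAbove_zero]
      simp only [Fin.succ_succAbove_succ]
    simp only [e2, Fin.succAbove_zero, Fin.val_zero, pow_zero, one_mul, Fin.val_succ, mul_add,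
      Finset.mul_sum, mul_smul_comm, sub_add_eq_sub_sub]
    have e3 : ∀ j : Fin (m + 1), ((-1 : R) ^ ((j : ℕ) + 1) * s j.succ)
        = -((-1 : R) ^ (j : ℕ) * s j.succ) := by intro j; ring
    simp only [e3, neg_smul, Finset.sum_neg_distrib]
    rw [pow_succ (-1 : A) (m + 1)]
    have e4 : b 0 * ((-1) ^ (m + 1) * ((List.ofFn fun i => b i.succ).prod * c))
        = (-1) ^ (m + 1) * (b 0 * ((List.ofFn fun i => b i.succ).prod * c)) := by
      rw [← mul_assoc, ← ((Commute.neg_one_left (b 0)).pow_left (m + 1)).eq, mul_assoc]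
    rw [e4]
    noncomm_ring

end Wick

/-! ## The Fock representation over `ℓ²` of the finite subsets -/

section EllTwoOperators

variable {ι : Type*}

theorem EllTwo.hasSum_norm_sq (f : EllTwo ι) : HasSum (fun i => ‖f i‖ ^ 2) (‖f‖ ^ 2) := by
  have := lp.hasSum_norm (p := 2) (by norm_num) f
  simpa using this

theorem EllTwo.memℓp_of_summable {f : ι → ℂ} (h : Summable fun i => ‖f i‖ ^ 2) :
    Memℓp (E := fun _ => ℂ) f 2 :=
  memℓp_gen (by simpa using h)

theorem basisVec_apply [DecidableEq ι] (i j : ι) :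
    (basisVec i : EllTwo ι) j = if j = i then 1 else 0 := by
  -- `basisVec` is defined with the classical instance, so the ambient one is first identified with
  -- it.
  obtain rfl : ‹DecidableEq ι› = fun a b => Classical.propDecidable (a = b) :=
    Subsingleton.elim _ _
  classical
  unfold basisVec
  rw [lp.single_apply, Pi.single_apply]

theorem inner_basisVec_left (i : ι) (f : EllTwo ι) : inner ℂ (basisVec i) f = f i := by
  classical
  have h : (basisVec i : EllTwo ι) = lp.single 2 i (1 : ℂ) := by
    ext j
    rw [basisVec_apply, lp.single_apply, Pi.single_apply]
  rw [h]
  exact (lp.inner_single_left (𝕜 := ℂ) (G := fun _ : ι => ℂ) i (1 : ℂ) f).trans (by simp)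

/-- Partial sums of the basis expansion converge. Identities that are continuous in `u ∈ ℓ²` can
therefore be checked on finitely supported vectors. -/
theorem denseRange_linearCombination_basisVec :
    DenseRange (Finsupp.linearCombination ℂ (basisVec : ι → EllTwo ι)) := by
  classical
  intro f
  have h := lp.hasSum_single (E := fun _ : ι => ℂ) (p := 2) (by norm_num) f
  refine mem_closure_of_tendsto h (Filter.Eventually.of_forall fun s => ?_)
  refine ⟨∑ i ∈ s, Finsupp.single i (f i), ?_⟩
  rw [map_sum]
  refine Finset.sum_congr rfl fun i _ => ?_
  rw [Finsupp.linearCombination_single]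
  ext j
  rw [lp.coeFn_smul, Pi.smul_apply, basisVec_apply, lp.single_apply, Pi.single_apply]
  simp

theorem hasSum_norm_sq_comp (e : Equiv.Perm ι) (ψ : EllTwo ι) :
    HasSum (fun i => ‖ψ (e i)‖ ^ 2) (‖ψ‖ ^ 2) :=
  e.hasSum_iff.2 (EllTwo.hasSum_norm_sq ψ)

theorem norm_mul_comp_sq_le {w : ι → ℂ} (hw : ∀ i, ‖w i‖ ≤ 1) (e : Equiv.Perm ι) (ψ : EllTwo ι)
    (i : ι) : ‖w i * ψ (e i)‖ ^ 2 ≤ ‖ψ (e i)‖ ^ 2 := by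
  rw [norm_mul]
  gcongr
  exact mul_le_of_le_one_left (norm_nonneg _) (hw i)

/-- The weighted composition operator `ψ ↦ w * (ψ ∘ e)` on `ℓ²`, as a linear map. -/
noncomputable def weightedCompₗ (w : ι → ℂ) (hw : ∀ i, ‖w i‖ ≤ 1) (e : Equiv.Perm ι) :
    EllTwo ι →ₗ[ℂ] EllTwo ι where
  toFun ψ := ⟨fun i => w i * ψ (e i), EllTwo.memℓp_of_summable
    (Summable.of_nonneg_of_le (fun _ => by positivity) (norm_mul_comp_sq_le hw e ψ)
      (hasSum_norm_sq_comp e ψ).summable)⟩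
  map_add' ψ φ := by
    ext i; exact mul_add _ _ _
  map_smul' c ψ := by
    ext i; exact mul_left_comm _ _ _

/-- The weighted composition operator `ψ ↦ w * (ψ ∘ e)` on `ℓ²`. -/
noncomputable def weightedComp (w : ι → ℂ) (hw : ∀ i, ‖w i‖ ≤ 1) (e : Equiv.Perm ι) :
    EllTwo ι →L[ℂ] EllTwo ι :=
  (weightedCompₗ w hw e).mkContinuous 1 fun ψ => by
    rw [one_mul]
    refine (sq_le_sq₀ (norm_nonneg _) (norm_nonneg _)).1 ?_
    exact hasSum_le (norm_mul_comp_sq_le hw e ψ)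
      (EllTwo.hasSum_norm_sq (weightedCompₗ w hw e ψ)) (hasSum_norm_sq_comp e ψ)

theorem weightedComp_apply (w : ι → ℂ) (hw : ∀ i, ‖w i‖ ≤ 1) (e : Equiv.Perm ι) (ψ : EllTwo ι)
    (i : ι) : weightedComp w hw e ψ i = w i * ψ (e i) := rfl

theorem star_weightedComp_apply (w : ι → ℂ) (hw : ∀ i, ‖w i‖ ≤ 1) (e : Equiv.Perm ι)
    (ψ : EllTwo ι) (i : ι) :
    star (weightedComp w hw e) ψ i = star (w (e.symm i)) * ψ (e.symm i) := by
  have h : star (weightedComp w hw e) = weightedComp (fun i => star (w (e.symm i)))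
      (fun i => by rw [norm_star]; exact hw _) e.symm := by
    rw [ContinuousLinearMap.star_eq_adjoint]
    symm
    rw [ContinuousLinearMap.eq_adjoint_iff]
    intro φ ψ
    -- Reindexing by `e` moves the composition from one factor of the inner product to the other.
    rw [lp.inner_eq_tsum, lp.inner_eq_tsum, ← e.tsum_eq]
    refine tsum_congr fun i => ?_
    rw [weightedComp_apply, weightedComp_apply]
    simp [mul_comm, mul_assoc, mul_left_comm]
  rw [h, weightedComp_apply]

end EllTwoOperators

/-! ### Creation operators and the canonical anticommutation relations -/

section Fock

variable {X : Type*} [LinearOrder X]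

/-- The fermionic Fock space over `ℓ²(X)`, with the basis of finite subsets of `X`. -/
abbrev Fock (X : Type*) : Type _ := EllTwo (Finset X)

/-- The Jordan–Wigner sign `(-1)^#{y ∈ S | x < y}`. -/
def jwSign (x : X) (S : Finset X) : ℂ := (-1) ^ (S.filter (x < ·)).card

theorem jwSign_mul_self (x : X) (S : Finset X) : jwSign x S * jwSign x S = 1 := by
  rw [jwSign, ← mul_pow]; simp

theorem norm_jwSign (x : X) (S : Finset X) : ‖jwSign x S‖ = 1 := by
  simp [jwSign]

/-- Adding or removing the point `x`. -/
def toggle (x : X) : Equiv.Perm (Finset X) :=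
  Function.Involutive.toPerm (fun S => symmDiff S {x}) fun S => by simp

theorem mem_toggle {x y : X} {S : Finset X} :
    y ∈ toggle x S ↔ y ∈ S ∧ y ≠ x ∨ y = x ∧ y ∉ S := by
  change y ∈ symmDiff S {x} ↔ _
  rw [Finset.mem_symmDiff, Finset.mem_singleton]

theorem toggle_of_mem {x : X} {S : Finset X} (h : x ∈ S) : toggle x S = S.erase x := by
  ext y
  rw [mem_toggle, Finset.mem_erase]
  by_cases hy : y = x
  · subst hy; simp [h]
  · simp [hy]

theorem toggle_of_notMem {x : X} {S : Finset X} (h : x ∉ S) : toggle x S = insert x S := by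
  ext y
  rw [mem_toggle, Finset.mem_insert]
  by_cases hy : y = x
  · subst hy; simp [h]
  · simp [hy]

theorem toggle_symm (x : X) : (toggle x).symm = toggle x := rfl

theorem toggle_toggle (x : X) (S : Finset X) : toggle x (toggle x S) = S :=
  (toggle x).apply_symm_apply S

theorem toggle_comm (x y : X) (S : Finset X) : toggle x (toggle y S) = toggle y (toggle x S) := by
  exact symmDiff_right_comm _ _ _

theorem mem_toggle_self {x : X} {S : Finset X} : x ∈ toggle x S ↔ x ∉ S := by
  simp [mem_toggle]

theorem mem_toggle_of_ne {x y : X} (h : x ≠ y) {S : Finset X} : x ∈ toggle y S ↔ x ∈ S := by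
  simp [mem_toggle, h]

theorem jwSign_toggle_of_not_lt {x y : X} (h : ¬ x < y) (S : Finset X) :
    jwSign x (toggle y S) = jwSign x S := by
  unfold jwSign
  congr 2
  ext z
  simp only [Finset.mem_filter, and_congr_left_iff]
  intro hz
  exact mem_toggle_of_ne (by rintro rfl; exact h hz)

/-- The point `y` is among those counted by the sign at `x`, so toggling it changes the parity. -/
theorem jwSign_toggle_of_lt {x y : X} (h : x < y) (S : Finset X) :
    jwSign x (toggle y S) = -jwSign x S := by
  have key : ∀ T : Finset X, y ∉ T → jwSign x (insert y T) = -jwSign x T := by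
    intro T hT
    unfold jwSign
    rw [Finset.filter_insert, if_pos h, Finset.card_insert_of_notMem (by simp [hT]), pow_succ]
    ring
  by_cases hy : y ∈ S
  · have := key (S.erase y) (Finset.notMem_erase y S)
    rw [Finset.insert_erase hy] at this
    rw [toggle_of_mem hy, this, neg_neg]
  · rw [toggle_of_notMem hy, key S hy]

/-- The creation operator at the site `x`. -/
noncomputable def createSite (x : X) : Fock X →L[ℂ] Fock X :=
  weightedComp (fun S => if x ∈ S then jwSign x S else 0)
    (fun S => by split_ifs <;> simp [norm_jwSign]) (toggle x)

theorem createSite_apply (x : X) (ψ : Fock X) (S : Finset X) :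
    createSite x ψ S = if x ∈ S then jwSign x S * ψ (toggle x S) else 0 := by
  rw [createSite, weightedComp_apply, ite_mul, zero_mul]

theorem star_createSite_apply (x : X) (ψ : Fock X) (S : Finset X) :
    star (createSite x) ψ S = if x ∈ S then 0 else jwSign x S * ψ (toggle x S) := by
  rw [createSite, star_weightedComp_apply, toggle_symm,
    jwSign_toggle_of_not_lt (lt_irrefl x)]
  by_cases h : x ∈ S <;> simp [mem_toggle_self, h, jwSign]

/-- For distinct sites, toggling the larger one flips the sign at the smaller one, but not
conversely; the two orders thus differ by exactly one sign. For equal sites, `x` would have to be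
both present and absent. -/
theorem createSite_anticomm (x y : X) :
    createSite x * createSite y + createSite y * createSite x = 0 := by
  ext ψ S
  change createSite x (createSite y ψ) S + createSite y (createSite x ψ) S = 0
  simp only [createSite_apply]
  rcases lt_trichotomy x y with h | rfl | h
  · simp only [mem_toggle_of_ne h.ne, mem_toggle_of_ne h.ne', jwSign_toggle_of_lt h,
      jwSign_toggle_of_not_lt h.not_gt, toggle_comm x y]
    split_ifs <;> ring
  · by_cases h : x ∈ S <;> simp [mem_toggle_self, h]
  · simp only [mem_toggle_of_ne h.ne, mem_toggle_of_ne h.ne', jwSign_toggle_of_lt h,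
      jwSign_toggle_of_not_lt h.not_gt, toggle_comm x y]
    split_ifs <;> ring

theorem star_createSite_anticomm (x y : X) :
    star (createSite x) * createSite y + createSite y * star (createSite x)
      = if x = y then 1 else 0 := by
  ext ψ S
  change star (createSite x) (createSite y ψ) S + createSite y (star (createSite x) ψ) S = _
  simp only [createSite_apply, star_createSite_apply]
  rcases lt_trichotomy x y with h | rfl | h
  · simp only [mem_toggle_of_ne h.ne, mem_toggle_of_ne h.ne', jwSign_toggle_of_lt h,
      jwSign_toggle_of_not_lt h.not_gt, toggle_comm x y, if_neg h.ne]
    split_ifs <;> (simp; try ring)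
  · simp only [mem_toggle_self, toggle_toggle, jwSign_toggle_of_not_lt (lt_irrefl x), if_true]
    have := jwSign_mul_self x S
    by_cases h : x ∈ S <;> simp [h, ← mul_assoc, this]
  · simp only [mem_toggle_of_ne h.ne, mem_toggle_of_ne h.ne', jwSign_toggle_of_lt h,
      jwSign_toggle_of_not_lt h.not_gt, toggle_comm x y, if_neg h.ne']
    split_ifs <;> (simp; try ring)

/-- The creation operators of finitely supported vectors. -/
noncomputable def createFinsupp : (X →₀ ℂ) →ₗ[ℂ] (Fock X →L[ℂ] Fock X) :=
  Finsupp.linearCombination ℂ createSite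

theorem star_createFinsupp_anticomm (u v : X →₀ ℂ) :
    star (createFinsupp u) * createFinsupp v + createFinsupp v * star (createFinsupp u)
      = (inner ℂ (Finsupp.linearCombination ℂ (basisVec : X → EllTwo X) u)
          (Finsupp.linearCombination ℂ (basisVec : X → EllTwo X) v) : ℂ) • 1 := by
  induction u using Finsupp.induction_linear with
  | zero => simp
  | add u u' hu hu' =>
    simp only [map_add, star_add, inner_add_left, add_smul, ← hu, ← hu']
    noncomm_ring
  | single x a =>
    induction v using Finsupp.induction_linear with
    | zero => simp
    | add v v' hv hv' =>
      simp only [map_add, inner_add_right, add_smul, ← hv, ← hv']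
      noncomm_ring
    | single y b =>
      simp only [createFinsupp, Finsupp.linearCombination_single, star_smul, inner_smul_left,
        inner_smul_right, inner_basisVec_left, basisVec_apply, smul_mul_assoc, mul_smul_comm,
        smul_smul]
      rw [mul_comm (star a), ← smul_add, star_createSite_anticomm]
      split_ifs <;> simp

theorem createFinsupp_anticomm (u v : X →₀ ℂ) :
    createFinsupp u * createFinsupp v + createFinsupp v * createFinsupp u = 0 := by
  induction u using Finsupp.induction_linear with
  | zero => simp
  | add u u' hu hu' =>
    rw [← add_zero (0 : Fock X →L[ℂ] Fock X)]
    nth_rewrite 1 [← hu]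
    rw [← hu']
    simp only [map_add]
    noncomm_ring
  | single x a =>
    induction v using Finsupp.induction_linear with
    | zero => simp
    | add v v' hv hv' =>
      rw [← add_zero (0 : Fock X →L[ℂ] Fock X)]
      nth_rewrite 1 [← hv]
      rw [← hv']
      simp only [map_add]
      noncomm_ring
    | single y b =>
      simp only [createFinsupp, Finsupp.linearCombination_single, smul_mul_assoc, mul_smul_comm,
        smul_smul]
      rw [mul_comm b, ← smul_add, createSite_anticomm, smul_zero]

/-- If `A† A + A A† = r²`, then `‖A ψ‖² + ‖A† ψ‖² = r² ‖ψ‖²`. -/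
theorem norm_sq_add_norm_star_sq {H : Type*} [NormedAddCommGroup H] [InnerProductSpace ℂ H]
    [CompleteSpace H] (A : H →L[ℂ] H) (r : ℝ) (h : star A * A + A * star A = ((r : ℂ) ^ 2) • 1)
    (ψ : H) : ‖A ψ‖ ^ 2 + ‖star A ψ‖ ^ 2 = r ^ 2 * ‖ψ‖ ^ 2 := by
  have h1 := congrArg (fun T : H →L[ℂ] H => inner ℂ ψ (T ψ)) h
  change inner ℂ ψ (ContinuousLinearMap.adjoint A (A ψ) + A (ContinuousLinearMap.adjoint A ψ))
    = inner ℂ ψ (((r : ℂ) ^ 2) • ψ) at h1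
  rw [inner_add_right, ContinuousLinearMap.adjoint_inner_right A ψ (A ψ), inner_smul_right,
    ← ContinuousLinearMap.adjoint_inner_left A _ ψ, inner_self_eq_norm_sq_to_K,
    inner_self_eq_norm_sq_to_K, inner_self_eq_norm_sq_to_K] at h1
  rw [ContinuousLinearMap.star_eq_adjoint]
  refine Complex.ofReal_injective ?_
  push_cast
  exact h1

/-- The anticommutation relation gives `‖a*(u)ψ‖² + ‖a(u)ψ‖² = ‖u‖² ‖ψ‖²`. This bound lets `a*`
extend continuously to all of `ℓ²`. -/
theorem norm_createFinsupp_le (u : X →₀ ℂ) :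
    ‖createFinsupp u‖ ≤ 1 * ‖Finsupp.linearCombination ℂ (basisVec : X → EllTwo X) u‖ := by
  rw [one_mul]
  refine ContinuousLinearMap.opNorm_le_bound _ (norm_nonneg _) fun ψ => ?_
  have h := norm_sq_add_norm_star_sq (createFinsupp u)
    ‖Finsupp.linearCombination ℂ (basisVec : X → EllTwo X) u‖
    (by rw [star_createFinsupp_anticomm, inner_self_eq_norm_sq_to_K]; rfl) ψ
  refine (sq_le_sq₀ (norm_nonneg _) (by positivity)).1 ?_
  rw [mul_pow, ← h]
  exact le_add_of_nonneg_right (sq_nonneg _)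

/-- The creation operator `a*(u)`, linear in `u ∈ ℓ²(X)`. -/
noncomputable def create : EllTwo X →L[ℂ] (Fock X →L[ℂ] Fock X) :=
  createFinsupp.extendOfNorm (Finsupp.linearCombination ℂ (basisVec : X → EllTwo X))

theorem create_linearCombination (u : X →₀ ℂ) :
    create (Finsupp.linearCombination ℂ (basisVec : X → EllTwo X) u) = createFinsupp u :=
  LinearMap.extendOfNorm_eq denseRange_linearCombination_basisVec ⟨1, norm_createFinsupp_le⟩ u

theorem create_basisVec (x : X) : create (basisVec x) = createSite x := by
  have := create_linearCombination (Finsupp.single x 1)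
  simpa [createFinsupp] using this

theorem star_create_anticomm (u v : EllTwo X) :
    star (create u) * create v + create v * star (create u) = (inner ℂ u v : ℂ) • 1 := by
  refine denseRange_linearCombination_basisVec.induction_on₂
    (p := fun u v => star (create u) * create v + create v * star (create u)
      = (inner ℂ u v : ℂ) • (1 : Fock X →L[ℂ] Fock X)) ?_ ?_ u v
  · exact isClosed_eq (by fun_prop) (by fun_prop)
  · intro u v
    rw [create_linearCombination, create_linearCombination, star_createFinsupp_anticomm]

theorem create_anticomm (u v : EllTwo X) :
    create u * create v + create v * create u = 0 := by
  refine denseRange_linearCombination_basisVec.induction_on₂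
    (p := fun u v => create u * create v + create v * create u
      = (0 : Fock X →L[ℂ] Fock X)) ?_ ?_ u v
  · exact isClosed_eq (by fun_prop) (by fun_prop)
  · intro u v
    rw [create_linearCombination, create_linearCombination, createFinsupp_anticomm]

theorem star_create_anticomm_star (u v : EllTwo X) :
    star (create u) * star (create v) + star (create v) * star (create u) = 0 := by
  rw [← star_mul, ← star_mul, ← star_add, create_anticomm, star_zero]

theorem norm_create_sq_add (u : EllTwo X) (ψ : Fock X) :
    ‖create u ψ‖ ^ 2 + ‖star (create u) ψ‖ ^ 2 = ‖u‖ ^ 2 * ‖ψ‖ ^ 2 :=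
  norm_sq_add_norm_star_sq (create u) ‖u‖
    (by rw [star_create_anticomm, inner_self_eq_norm_sq_to_K]; rfl) ψ

theorem continuous_ellTwo_apply {ι : Type*} (i : ι) :
    Continuous fun f : EllTwo ι => f i :=
  (lp.evalCLM ℂ (fun _ : ι => ℂ) 2 i).continuous

/-- Both sides are linear and continuous in `u`, so only `u = e_y` matters. The formula has the
shape of a Laplace expansion, which is how determinants enter. -/
theorem create_apply (u : EllTwo X) (ψ : Fock X) (S : Finset X) :
    create u ψ S = ∑ x ∈ S, jwSign x S * u x * ψ (S.erase x) := by
  refine denseRange_linearCombination_basisVec.induction_on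
    (p := fun u => create u ψ S = ∑ x ∈ S, jwSign x S * u x * ψ (S.erase x)) u ?_ ?_
  · refine isClosed_eq ((continuous_ellTwo_apply S).comp (by fun_prop)) ?_
    refine continuous_finsetSum _ fun x _ => ?_
    exact (continuous_const.mul (continuous_ellTwo_apply x)).mul continuous_const
  · intro u
    rw [create_linearCombination]
    induction u using Finsupp.induction_linear with
    | zero => simp
    | add u v hu hv =>
      simp only [map_add, add_apply, lp.coeFn_add, Pi.add_apply, hu, hv]
      rw [← Finset.sum_add_distrib]
      exact Finset.sum_congr rfl fun x _ => by ring
    | single y b =>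
      simp only [createFinsupp, Finsupp.linearCombination_single, smul_apply,
        lp.coeFn_smul, Pi.smul_apply, createSite_apply, basisVec_apply, smul_eq_mul]
      by_cases hy : y ∈ S
      · rw [if_pos hy, Finset.sum_eq_single_of_mem y hy (fun x _ hx => by simp [hx]), if_pos rfl,
          toggle_of_mem hy]
        ring
      · rw [if_neg hy, Finset.sum_eq_zero, mul_zero]
        intro x hx
        rw [if_neg (by rintro rfl; exact hy hx)]
        ring

end Fock

/-! ## Representations of the CAR algebra and Wick's formula -/

namespace CAR

variable {𝒦 : Type*} [NormedAddCommGroup 𝒦] [InnerProductSpace ℂ 𝒦]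
  {Γ : AntiunitaryInvolution 𝒦} {A : Type*} [CStarAlgebra A] (b : 𝒦 →ₗ[ℂ] A)
  (hstar : ∀ f, star (b f) = b (Γ.toMap f))
  (hanti : ∀ f g, star (b f) * b g + b g * star (b f) = algebraMap ℂ A (inner ℂ f g))

/-- The morphism of `𝒞₀(𝒦, Γ)` given by a representation of the relations. -/
noncomputable def lift₀ : Alg Γ →ₐ[ℂ] A :=
  RingQuot.liftAlgHom ℂ (s := Rel Γ)
    ⟨FreeAlgebra.lift ℂ b, by
      intro x y h
      induction h with
      | add f g => simp only [map_add, FreeAlgebra.lift_ι_apply]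
      | smul c f => simp only [map_smul, FreeAlgebra.lift_ι_apply]
      | anticomm f g =>
        simp only [map_add, map_mul, FreeAlgebra.lift_ι_apply, AlgHom.commutes]
        rw [← hstar, hanti]⟩

theorem lift₀_B₀ (f : 𝒦) : lift₀ b hstar hanti (B₀ Γ f) = b f := by
  unfold lift₀ B₀ quot
  exact (RingQuot.liftAlgHom_mkAlgHom_apply ℂ _ _ _).trans (FreeAlgebra.lift_ι_apply _ _)

theorem lift₀_star (a : Alg Γ) :
    lift₀ b hstar hanti (star a) = star (lift₀ b hstar hanti a) := by
  induction a using alg_induction with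
  | scalar c =>
    rw [star_algebraMap, AlgHom.commutes, AlgHom.commutes, ← algebraMap_star_comm]
    rfl
  | gen f => rw [star_B₀, lift₀_B₀, lift₀_B₀, hstar]
  | mul x y hx hy => rw [star_mul, map_mul, map_mul, star_mul, hx, hy]
  | add x y hx hy => rw [star_add, map_add, map_add, star_add, hx, hy]

/-- The norm of `Alg Γ` is the supremum of all C*-seminorms, and the norm of `A` pulled back along
`lift₀` is one of them. -/
theorem norm_lift₀_le (a : Alg Γ) : ‖lift₀ b hstar hanti a‖ ≤ ‖a‖ := by
  have hp : IsCStarSeminorm ((normSeminorm ℂ A).comp (lift₀ b hstar hanti).toLinearMap) := by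
    refine ⟨fun x y => ?_, fun x => ?_⟩
    · simp only [Seminorm.comp_apply, AlgHom.toLinearMap_apply, map_mul, coe_normSeminorm]
      exact norm_mul_le _ _
    · simp only [Seminorm.comp_apply, AlgHom.toLinearMap_apply, map_mul, coe_normSeminorm,
        lift₀_star, CStarRing.norm_star_mul_self, sq]
  exact le_normFun Γ hp a

theorem continuous_lift₀ : Continuous (lift₀ b hstar hanti) :=
  (LinearMap.mkContinuous (lift₀ b hstar hanti).toLinearMap 1 fun a => by
    rw [one_mul]; exact norm_lift₀_le b hstar hanti a).continuous

/-- The extension of `lift₀` to the C*-algebra, as a ring morphism. -/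
noncomputable def liftRingHom : CStar Γ →+* A :=
  UniformSpace.Completion.extensionHom (lift₀ b hstar hanti).toRingHom
    (continuous_lift₀ b hstar hanti)

theorem continuous_liftRingHom : Continuous (liftRingHom b hstar hanti) :=
  UniformSpace.Completion.continuous_extension

theorem liftRingHom_toCStar (a : Alg Γ) :
    liftRingHom b hstar hanti (toCStar Γ a) = lift₀ b hstar hanti a :=
  UniformSpace.Completion.extensionHom_coe _ _ a

/-- The representation of `𝒞(𝒦, Γ)` given by a representation of the relations. -/
noncomputable def lift : CStar Γ →⋆ₐ[ℂ] A where
  __ := liftRingHom b hstar hanti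
  commutes' c := by
    have := liftRingHom_toCStar b hstar hanti (algebraMap ℂ _ c)
    rwa [AlgHom.commutes, AlgHom.commutes] at this
  map_star' a := by
    refine (denseRange_toCStar Γ).induction_on
      (p := fun a => liftRingHom b hstar hanti (star a) = star (liftRingHom b hstar hanti a)) a
      (isClosed_eq ((continuous_liftRingHom b hstar hanti).comp continuous_star)
        (continuous_liftRingHom b hstar hanti).star) fun a => ?_
    rw [star_toCStar, liftRingHom_toCStar, liftRingHom_toCStar, lift₀_star]

theorem lift_B (f : 𝒦) : lift b hstar hanti (B Γ f) = b f :=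
  (liftRingHom_toCStar b hstar hanti _).trans (lift₀_B₀ b hstar hanti f)

end CAR

/-! ### Vector states and the Pfaffian recursion -/

section VectorState

variable {A : Type*} [CStarAlgebra A] {H : Type*} [NormedAddCommGroup H] [InnerProductSpace ℂ H]
  [CompleteSpace H]

/-- A representation on a Hilbert space as a continuous linear map. -/
noncomputable def StarAlgHom.toCLM (π : A →⋆ₐ[ℂ] (H →L[ℂ] H)) : A →L[ℂ] (H →L[ℂ] H) :=
  (π : A →ₐ[ℂ] (H →L[ℂ] H)).toLinearMap.mkContinuous 1 fun a => by
    rw [one_mul]; exact NonUnitalStarAlgHom.norm_apply_le π a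

/-- The vector functional `a ↦ (Ψ, π(a) Ψ)`. -/
noncomputable def vectorFunctional (π : A →⋆ₐ[ℂ] (H →L[ℂ] H)) (Ψ : H) : A →L[ℂ] ℂ :=
  (innerSL ℂ Ψ).comp ((ContinuousLinearMap.apply ℂ H Ψ).comp π.toCLM)

theorem vectorFunctional_apply (π : A →⋆ₐ[ℂ] (H →L[ℂ] H)) (Ψ : H) (a : A) :
    vectorFunctional π Ψ a = inner ℂ Ψ (π a Ψ) := rfl

theorem vectorFunctional_nonneg (π : A →⋆ₐ[ℂ] (H →L[ℂ] H)) (Ψ : H) (a : A) :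
    0 ≤ vectorFunctional π Ψ (star a * a) := by
  rw [vectorFunctional_apply, map_mul, map_star, ContinuousLinearMap.star_eq_adjoint]
  change 0 ≤ inner ℂ Ψ (ContinuousLinearMap.adjoint (π a) (π a Ψ))
  rw [ContinuousLinearMap.adjoint_inner_right, inner_self_eq_norm_sq_to_K]
  have := Complex.zero_le_real.2 (sq_nonneg ‖π a Ψ‖)
  rwa [Complex.ofReal_pow] at this

theorem norm_vectorFunctional (π : A →⋆ₐ[ℂ] (H →L[ℂ] H)) {Ψ : H} (hΨ : ‖Ψ‖ = 1) :
    ‖vectorFunctional π Ψ‖ = 1 := by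
  refine le_antisymm (ContinuousLinearMap.opNorm_le_bound _ zero_le_one fun a => ?_) ?_
  · rw [vectorFunctional_apply, one_mul]
    calc ‖inner ℂ Ψ (π a Ψ)‖ ≤ ‖Ψ‖ * ‖π a Ψ‖ := norm_inner_le_norm _ _
      _ ≤ 1 * (‖π a‖ * 1) := by
        rw [hΨ]; gcongr; simpa [hΨ] using (π a).le_opNorm Ψ
      _ ≤ ‖a‖ := by rw [one_mul, mul_one]; exact NonUnitalStarAlgHom.norm_apply_le π a
  · have h1 : vectorFunctional π Ψ 1 = 1 := by
      rw [vectorFunctional_apply, map_one]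
      change inner ℂ Ψ Ψ = _
      rw [inner_self_eq_norm_sq_to_K, hΨ]; simp
    -- `‖1‖ = 1` needs a nontrivial algebra, which follows from the functional taking the value `1`
    -- at `1`.
    have : Nontrivial A := ⟨⟨0, 1, fun h => by rw [← h] at h1; simp at h1⟩⟩
    have := (vectorFunctional π Ψ).le_opNorm 1
    rwa [h1, norm_one, CStarRing.norm_one, mul_one] at this

/-- `Ψ` is a quasi-free vector for the operators `b f`: each `b f` is the sum of an operator `c`
annihilating `Ψ` and anticommuting with the `b g` up to scalars, and of an operator whose adjoint
annihilates `Ψ`. -/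
structure IsPolarized {V : Type*} (b : V → H →L[ℂ] H) (Ψ : H) : Prop where
  norm_eq_one : ‖Ψ‖ = 1
  exists_split : ∀ f, ∃ c : H →L[ℂ] H, c Ψ = 0 ∧ star (b f - c) Ψ = 0 ∧
    ∀ g, ∃ s : ℂ, c * b g + b g * c = algebraMap ℂ _ s

variable {V : Type*} {b : V → H →L[ℂ] H} {Ψ : H}

theorem inner_apply_of_star_sub {T c : H →L[ℂ] H} (h : star (T - c) Ψ = 0) (Y : H) :
    inner ℂ Ψ (T Y) = inner ℂ Ψ (c Y) := by
  rw [← sub_eq_zero, ← inner_sub_right, ← sub_apply,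
    ← ContinuousLinearMap.adjoint_inner_left, ← ContinuousLinearMap.star_eq_adjoint, h,
    inner_zero_left]

/-- Against `Ψ` on the left, the first operator may be replaced by its part `c`. Anticommuting `c`
to the far right, it kills `Ψ`; the scalars produced on the way are the two-point functions. -/
theorem IsPolarized.expansion (hΨ : IsPolarized b Ψ) (m : ℕ) (f : Fin (m + 2) → V) :
    inner ℂ Ψ ((List.ofFn fun i => b (f i)).prod Ψ) = ∑ j : Fin (m + 1),
      (-1) ^ (j : ℕ) * inner ℂ Ψ ((b (f 0) * b (f j.succ)) Ψ) *
        inner ℂ Ψ ((List.ofFn fun i => b (f (j.succAbove i).succ)).prod Ψ) := by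
  obtain ⟨c, hc, hstar, hs⟩ := hΨ.exists_split (f 0)
  choose s hs using hs
  have hw : ∀ g, inner ℂ Ψ ((b (f 0) * b g) Ψ) = s g := by
    intro g
    change inner ℂ Ψ (b (f 0) (b g Ψ)) = _
    rw [inner_apply_of_star_sub hstar]
    have h1 := congrArg (fun T : H →L[ℂ] H => T Ψ) (hs g)
    change c (b g Ψ) + b g (c Ψ) = _ at h1
    rw [hc, map_zero, add_zero, Algebra.algebraMap_eq_smul_one] at h1
    change _ = s g • Ψ at h1
    rw [h1, inner_smul_right, inner_self_eq_norm_sq_to_K, hΨ.norm_eq_one]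
    simp
  rw [List.ofFn_succ, List.prod_cons]
  change inner ℂ Ψ (b (f 0) ((List.ofFn fun i : Fin (m + 1) => b (f i.succ)).prod Ψ)) = _
  rw [inner_apply_of_star_sub hstar]
  have h2 := mul_prod_ofFn_of_anticomm (R := ℂ) c m (fun i => b (f i.succ)) (fun i => s (f i.succ))
    (fun i => hs _)
  have h3 := congrArg (fun T : H →L[ℂ] H => T Ψ) h2
  have h4 : ((-1 : H →L[ℂ] H) ^ (m + 1) * ((List.ofFn fun i : Fin (m + 1) =>
      b (f i.succ)).prod * c)) Ψ = 0 := by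
    change ((-1 : H →L[ℂ] H) ^ (m + 1)) ((List.ofFn fun i : Fin (m + 1) =>
      b (f i.succ)).prod (c Ψ)) = 0
    rw [hc, map_zero, map_zero]
  rw [add_apply, h4, add_zero, sum_apply] at h3
  change c ((List.ofFn fun i : Fin (m + 1) => b (f i.succ)).prod Ψ) = _ at h3
  rw [h3, inner_sum]
  refine Finset.sum_congr rfl fun j _ => ?_
  rw [smul_apply, inner_smul_right, hw]

theorem IsPolarized.odd (hΨ : IsPolarized b Ψ) : ∀ (n : ℕ) (f : Fin (2 * n + 1) → V),
    inner ℂ Ψ ((List.ofFn fun i => b (f i)).prod Ψ) = 0 := by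
  intro n
  induction n with
  | zero =>
    intro f
    obtain ⟨c, hc, hstar, -⟩ := hΨ.exists_split (f 0)
    rw [List.ofFn_succ, List.prod_cons]
    change inner ℂ Ψ (b (f 0) Ψ) = _
    rw [inner_apply_of_star_sub hstar, hc, inner_zero_right]
  | succ n ih =>
    intro f
    refine (hΨ.expansion (2 * n + 1) f).trans (Finset.sum_eq_zero fun j _ => ?_)
    rw [ih, mul_zero]

end VectorState

theorem CAR.isQuasiFree_vectorFunctional {𝒦 : Type*} [NormedAddCommGroup 𝒦]
    [InnerProductSpace ℂ 𝒦] {Γ : AntiunitaryInvolution 𝒦} {H : Type*} [NormedAddCommGroup H]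
    [InnerProductSpace ℂ H] [CompleteSpace H] (π : CStar Γ →⋆ₐ[ℂ] (H →L[ℂ] H)) {Ψ : H}
    (hΨ : IsPolarized (fun f => π (B Γ f)) Ψ) : IsQuasiFree Γ (vectorFunctional π Ψ) where
  isState := ⟨vectorFunctional_nonneg π Ψ, norm_vectorFunctional π hΨ.norm_eq_one⟩
  odd n f := by
    rw [vectorFunctional_apply, map_list_prod, List.map_ofFn]
    exact hΨ.odd n f
  even n f := by
    have h := wick_of_recursion
      (fun m f => inner ℂ Ψ ((List.ofFn fun i : Fin m => π (B Γ (f i))).prod Ψ))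
      (fun f g => inner ℂ Ψ ((π (B Γ f) * π (B Γ g)) Ψ))
      (fun f => by
        change inner ℂ Ψ Ψ = _
        rw [inner_self_eq_norm_sq_to_K, hΨ.norm_eq_one]; simp)
      hΨ.expansion n (n + n) rfl f
    simp only [vectorFunctional_apply, map_mul]
    rw [map_list_prod, List.map_ofFn]
    refine h.trans (congrArg _ (Finset.sum_congr ?_ fun _ _ => rfl))
    -- For `m = n + n` the positions `leftPos` and `rightPos` are definitionally `castAdd` and
    -- `natAdd`, so the two conditions on `σ` agree.
    ext σ
    simp only [Finset.mem_filter]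
    rfl

/-! ### The Fock representation of the CAR algebra -/

section FockRep

variable {X : Type*} [LinearOrder X]

/-- The operators of the Fock representation: `B(u, v) = a*(u) + a(Jv)`. -/
noncomputable def fieldOp : Doubled X →ₗ[ℂ] (Fock X →L[ℂ] Fock X) where
  toFun f := create f.fst + star (create (star f.snd))
  map_add' f g := by
    simp only [WithLp.add_fst, WithLp.add_snd, star_add, map_add]
    abel
  map_smul' c f := by
    simp only [WithLp.smul_fst, WithLp.smul_snd, star_smul, map_smul, star_star, smul_add,
      RingHom.id_apply]

theorem fieldOp_apply (f : Doubled X) :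
    fieldOp f = create f.fst + star (create (star f.snd)) := rfl

theorem star_fieldOp (f : Doubled X) :
    star (fieldOp f) = fieldOp ((doubledInvolution X).toMap f) := by
  change star (create f.fst + star (create (star f.snd)))
    = create (star f.snd) + star (create (star (star f.fst)))
  rw [star_add, star_star, star_star, add_comm]

theorem inner_star_star {X : Type*} (u v : EllTwo X) :
    inner ℂ (star u) (star v) = (inner ℂ v u : ℂ) := by
  rw [lp.inner_eq_tsum, lp.inner_eq_tsum]
  refine tsum_congr fun x => ?_
  simp [mul_comm]

/-- Of the four groups of terms, creator–creator and annihilator–annihilator vanish. The mixed ones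
give the inner products of the two components, the second one reversed and restored by the
antiunitarity of `J`. -/
theorem fieldOp_anticomm (f g : Doubled X) :
    star (fieldOp f) * fieldOp g + fieldOp g * star (fieldOp f)
      = algebraMap ℂ _ (inner ℂ f g) := by
  have h1 := star_create_anticomm f.fst g.fst
  have h2 := star_create_anticomm (star g.snd) (star f.snd)
  have h3 := create_anticomm (star f.snd) g.fst
  have h4 := star_create_anticomm_star f.fst (star g.snd)
  rw [inner_star_star] at h2
  rw [Algebra.algebraMap_eq_smul_one, WithLp.prod_inner_apply]
  change _ = ((inner ℂ f.fst g.fst + inner ℂ f.snd g.snd : ℂ)) • (1 : Fock X →L[ℂ] Fock X)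
  rw [add_smul, ← h1, ← h2, fieldOp_apply, fieldOp_apply, star_add, star_star]
  calc _ = (star (create f.fst) * create g.fst + create g.fst * star (create f.fst))
        + (star (create (star g.snd)) * create (star f.snd)
          + create (star f.snd) * star (create (star g.snd)))
        + (create (star f.snd) * create g.fst + create g.fst * create (star f.snd))
        + (star (create f.fst) * star (create (star g.snd))
          + star (create (star g.snd)) * star (create f.fst)) := by noncomm_ring
    _ = _ := by rw [h3, h4, add_zero, add_zero]

/-- The Fock representation of the CAR algebra. -/
noncomputable def fockRep : CARAlgebra X →⋆ₐ[ℂ] (Fock X →L[ℂ] Fock X) :=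
  CAR.lift fieldOp star_fieldOp fieldOp_anticomm

theorem fockRep_B (f : Doubled X) : fockRep (CAR.B (doubledInvolution X) f) = fieldOp f :=
  CAR.lift_B _ _ _ f

theorem fockRep_annih (x : X) : fockRep (annih x) = star (createSite x) := by
  classical
  rw [annih, fockRep_B, fieldOp_apply]
  have h : star (basisVec x) = (basisVec x : EllTwo X) := by
    ext y
    rw [lp.star_apply, basisVec_apply]
    split_ifs <;> simp
  change create (0 : EllTwo X) + star (create (star (basisVec x))) = _
  rw [map_zero, zero_add, h, create_basisVec]

/-- If `a*(P u)` and `a(u - P u)` annihilate `Ψ` for all `u`, then `Ψ` is a quasi-free vector. -/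
theorem isPolarized_fockRep {Ψ : Fock X} (h1 : ‖Ψ‖ = 1) (P : EllTwo X → EllTwo X)
    (hP : ∀ u, create (P u) Ψ = 0) (hP' : ∀ u, star (create (u - P u)) Ψ = 0) :
    IsPolarized (fun f => fockRep (CAR.B (doubledInvolution X) f)) Ψ where
  norm_eq_one := h1
  exists_split f := by
    set v := star f.snd with hv
    -- With `v = J f₂`, the annihilating part is `c = a*(P f₁) + a(v - P v)`. The adjoint of the
    -- rest is `a(f₁ - P f₁) + a*(P v)`, which annihilates `Ψ` as well.
    refine ⟨fieldOp (WithLp.toLp 2 (P f.fst, star (v - P v))), ?_, ?_, fun g => ?_⟩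
    · change create (P f.fst) Ψ + star (create (star (star (v - P v)))) Ψ = 0
      rw [star_star, hP, hP', add_zero]
    · rw [fockRep_B, fieldOp_apply, fieldOp_apply]
      change star (create f.fst + star (create v)
        - (create (P f.fst) + star (create (star (star (v - P v)))))) Ψ = 0
      have : create f.fst + star (create v)
          - (create (P f.fst) + star (create (star (star (v - P v)))))
          = create (f.fst - P f.fst) + star (create (P v)) := by
        rw [star_star, map_sub, map_sub, star_sub]; abel
      rw [this, star_add, star_star, add_apply, hP, hP', add_zero]
    · rw [fockRep_B]
      set k : Doubled X := WithLp.toLp 2 (P f.fst, star (v - P v))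
      -- As `Γ² = 1`, the adjoint of `B(Γk)` is `B(k)`, so this is the anticommutator of `B(k)`
      -- itself with `B(g)`.
      have := fieldOp_anticomm ((doubledInvolution X).toMap k) g
      rw [star_fieldOp, (doubledInvolution X).involutive] at this
      exact ⟨_, this⟩

end FockRep

/-! ## Slater determinants -/

section Slater

variable {X : Type*} [LinearOrder X]

/-- The product `a*(v₁) ⋯ a*(vₙ)`. -/
noncomputable def createProd {n : ℕ} (v : Fin n → EllTwo X) : Fock X →L[ℂ] Fock X :=
  (List.ofFn fun i => create (v i)).prod

theorem createProd_zero (v : Fin 0 → EllTwo X) : createProd v = 1 := by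
  simp [createProd]

theorem createProd_succ {n : ℕ} (v : Fin (n + 1) → EllTwo X) :
    createProd v = create (v 0) * createProd (Fin.tail v) := by
  rw [createProd, List.ofFn_succ, List.prod_cons]
  rfl

/-- The vector `a*(v₁) ⋯ a*(vₙ) Ω`. -/
noncomputable def slater {n : ℕ} (v : Fin n → EllTwo X) : Fock X :=
  createProd v (basisVec ∅)

theorem slater_zero (v : Fin 0 → EllTwo X) : slater v = basisVec ∅ := by
  rw [slater, createProd_zero]; rfl

theorem slater_succ {n : ℕ} (v : Fin (n + 1) → EllTwo X) :
    slater v = create (v 0) (slater (Fin.tail v)) := by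
  rw [slater, createProd_succ]; rfl

theorem create_create (u v : EllTwo X) (ψ : Fock X) :
    create u (create v ψ) = -create v (create u ψ) :=
  eq_neg_of_add_eq_zero_left (congrArg (fun T : Fock X →L[ℂ] Fock X => T ψ) (create_anticomm u v))

theorem star_create_create (u v : EllTwo X) (ψ : Fock X) :
    star (create u) (create v ψ)
      = (inner ℂ u v : ℂ) • ψ - create v (star (create u) ψ) :=
  eq_sub_of_add_eq (congrArg (fun T : Fock X →L[ℂ] Fock X => T ψ) (star_create_anticomm u v))

/-- The new factor anticommutes up to its own copy in the product, and `a*(v)² = 0`. -/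
theorem create_slater_self {n : ℕ} (v : Fin n → EllTwo X) (i : Fin n) :
    create (v i) (slater v) = 0 := by
  induction n with
  | zero => exact i.elim0
  | succ n ih =>
    rw [slater_succ]
    induction i using Fin.cases with
    | zero =>
      have h := create_create (v 0) (v 0) (slater (Fin.tail v))
      have h2 : (2 : ℂ) • create (v 0) (create (v 0) (slater (Fin.tail v))) = 0 := by
        rw [two_smul]; exact eq_neg_iff_add_eq_zero.1 h
      exact (smul_eq_zero.1 h2).resolve_left two_ne_zero
    | succ i =>
      rw [create_create]
      have := ih (Fin.tail v) i
      rw [Fin.tail] at this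
      rw [this, map_zero, neg_zero]

theorem create_slater_of_mem_span {n : ℕ} (v : Fin n → EllTwo X) {u : EllTwo X}
    (hu : u ∈ Submodule.span ℂ (Set.range v)) : create u (slater v) = 0 := by
  induction hu using Submodule.span_induction with
  | mem u hu =>
    obtain ⟨i, rfl⟩ := hu
    exact create_slater_self v i
  | zero => rw [map_zero]; rfl
  | add u u' _ _ h h' => rw [map_add, add_apply, h, h', add_zero]
  | smul c u _ h => rw [map_smul, smul_apply, h, smul_zero]

theorem star_create_vacuum (u : EllTwo X) : star (create u) (basisVec ∅) = 0 := by
  ext S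
  rw [← inner_basisVec_left, ContinuousLinearMap.star_eq_adjoint,
    ContinuousLinearMap.adjoint_inner_right, ← inner_conj_symm, inner_basisVec_left, create_apply]
  simp

/-- Every contraction with a factor vanishes, so `a(u)` reaches the vacuum and kills it. -/
theorem star_create_slater_of_orthogonal {n : ℕ} (v : Fin n → EllTwo X) {u : EllTwo X}
    (hu : ∀ i, inner ℂ u (v i) = (0 : ℂ)) : star (create u) (slater v) = 0 := by
  induction n with
  | zero => rw [slater_zero, star_create_vacuum]
  | succ n ih =>
    rw [slater_succ, star_create_create, hu, zero_smul, ih (Fin.tail v) fun i => hu i.succ,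
      map_zero, sub_zero]

instance finiteDimensional_span_range {E : Type*} [AddCommGroup E] [Module ℂ E] {n : ℕ}
    (v : Fin n → E) : FiniteDimensional ℂ (Submodule.span ℂ (Set.range v)) :=
  FiniteDimensional.span_of_finite ℂ (Set.finite_range v)

/-- The orthogonal projection onto the span of finitely many vectors. -/
noncomputable def spanProj {n : ℕ} (v : Fin n → EllTwo X) : EllTwo X →L[ℂ] EllTwo X :=
  (Submodule.span ℂ (Set.range v)).starProjection

theorem create_spanProj_slater {n : ℕ} (v : Fin n → EllTwo X) (u : EllTwo X) :
    create (spanProj v u) (slater v) = 0 :=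
  create_slater_of_mem_span v (Submodule.starProjection_apply_mem _ _)

theorem star_create_sub_spanProj_slater {n : ℕ} (v : Fin n → EllTwo X) (u : EllTwo X) :
    star (create (u - spanProj v u)) (slater v) = 0 :=
  star_create_slater_of_orthogonal v fun i => by
    rw [← inner_conj_symm]
    have h := (Submodule.span ℂ (Set.range v)).sub_starProjection_mem_orthogonal u
    rw [Submodule.mem_orthogonal] at h
    rw [spanProj, h _ (Submodule.subset_span ⟨i, rfl⟩), map_zero]

/-- In the first factor, `v 0` may be replaced by its component `w` orthogonal to the other vectors,
nonzero by independence. Since `a(w)` kills the remaining product `t`, the anticommutation relation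
gives `‖a*(w) t‖ = ‖w‖ ‖t‖`. -/
theorem slater_ne_zero {n : ℕ} (v : Fin n → EllTwo X) (hv : LinearIndependent ℂ v) :
    slater v ≠ 0 := by
  induction n with
  | zero =>
    intro h
    have := inner_basisVec_left (∅ : Finset X) (slater v)
    rw [h, inner_zero_right, ← h, slater_zero, basisVec_apply] at this
    simp at this
  | succ n ih =>
    rw [linearIndependent_finSucc] at hv
    rw [slater_succ]
    set t := slater (Fin.tail v) with ht
    set w := v 0 - spanProj (Fin.tail v) (v 0) with hw
    have h1 : create (v 0) t = create w t := by
      rw [hw, map_sub, sub_apply, create_spanProj_slater, sub_zero]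
    have hw0 : w ≠ 0 := by
      intro h0
      rw [hw, sub_eq_zero] at h0
      refine hv.2 ?_
      rw [h0]
      exact Submodule.starProjection_apply_mem _ _
    have h2 := norm_create_sq_add w t
    rw [star_create_sub_spanProj_slater, norm_zero] at h2
    intro h
    rw [← h1, h, norm_zero] at h2
    have h3 : 0 < ‖w‖ ^ 2 * ‖t‖ ^ 2 :=
      mul_pos (pow_pos (norm_pos_iff.2 hw0) 2) (pow_pos (norm_pos_iff.2 (ih _ hv.1)) 2)
    linarith [h2, h3]

theorem slater_apply_of_card_ne {n : ℕ} (v : Fin n → EllTwo X) {S : Finset X} (h : S.card ≠ n) :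
    slater v S = 0 := by
  induction n generalizing S with
  | zero =>
    rw [slater_zero, basisVec_apply, if_neg]
    rintro rfl; simp at h
  | succ n ih =>
    rw [slater_succ, create_apply]
    refine Finset.sum_eq_zero fun x hx => ?_
    rw [ih, mul_zero]
    rw [Finset.card_erase_of_mem hx]
    have := Finset.card_pos.2 ⟨x, hx⟩
    omega

/-- In a decreasing enumeration the points above `x j` are the `x i` with `i < j`. This sign is the
one in the expansion of a determinant along its first row. -/
theorem jwSign_image_of_strictAnti {n : ℕ} {x : Fin n → X} (hx : StrictAnti x) (j : Fin n) :
    jwSign (x j) (Finset.univ.image x) = (-1) ^ (j : ℕ) := by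
  rw [jwSign, Finset.filter_image, Finset.card_image_of_injective _ hx.injective]
  have h : (Finset.univ.filter fun i => x j < x i) = Finset.Iio j := by
    ext i
    simp [hx.lt_iff_gt]
  exact congrArg _ ((congrArg Finset.card h).trans (Fin.card_Iio j))

theorem slater_apply_image {n : ℕ} (v : Fin n → EllTwo X) {x : Fin n → X} (hx : StrictAnti x) :
    slater v (Finset.univ.image x) = (Matrix.of fun i j => v i (x j)).det := by
  induction n with
  | zero => simp [slater_zero, basisVec_apply]
  | succ n ih =>
    rw [slater_succ, create_apply, Finset.sum_image fun _ _ _ _ h => hx.injective h,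
      Matrix.det_succ_row_zero]
    refine Finset.sum_congr rfl fun j _ => ?_
    have hS : (Finset.univ.image x).erase (x j)
        = Finset.univ.image fun i => x (j.succAbove i) := by
      ext y
      simp only [Finset.mem_erase, Finset.mem_image, Finset.mem_univ, true_and]
      constructor
      · rintro ⟨hy, i, rfl⟩
        obtain ⟨k, rfl⟩ := Fin.exists_succAbove_eq fun e : i = j => hy (by rw [e])
        exact ⟨k, rfl⟩
      · rintro ⟨k, rfl⟩
        exact ⟨fun e => Fin.succAbove_ne j k (hx.injective e), _, rfl⟩
    have h := ih (Fin.tail v) (x := fun i => x (j.succAbove i))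
      (hx.comp_strictMono (Fin.strictMono_succAbove j))
    rw [hS, jwSign_image_of_strictAnti hx, h]
    rfl

theorem exists_strictAnti_image_eq {n : ℕ} {S : Finset X} (h : S.card = n) :
    ∃ x : Fin n → X, StrictAnti x ∧ Finset.univ.image x = S := by
  refine ⟨fun i => S.orderEmbOfFin h i.rev,
    fun i j hij => (S.orderEmbOfFin h).strictMono (Fin.rev_lt_rev.2 hij), ?_⟩
  ext y
  have h1 : y ∈ S ↔ y ∈ Set.range (S.orderEmbOfFin h) := by
    rw [Finset.range_orderEmbOfFin, Finset.mem_coe]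
  rw [h1]
  simp only [Finset.mem_image, Finset.mem_univ, true_and, Set.mem_range]
  exact ⟨fun ⟨i, hi⟩ => ⟨i.rev, hi⟩, fun ⟨i, hi⟩ => ⟨i.rev, by rwa [Fin.rev_rev]⟩⟩

theorem slater_apply_nonneg {n : ℕ} {v : Fin n → EllTwo X} (hv : NonnegMinors v) (S : Finset X) :
    0 ≤ slater v S := by
  by_cases h : S.card = n
  · obtain ⟨x, hx, rfl⟩ := exists_strictAnti_image_eq h
    rw [slater_apply_image v hx]
    exact hv x hx
  · rw [slater_apply_of_card_ne v h]

/-! ## The correlation functions -/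

theorem star_createProd_succ {n : ℕ} (v : Fin (n + 1) → EllTwo X) :
    star (createProd v) = star (createProd (Fin.tail v)) * star (create (v 0)) := by
  rw [createProd_succ, star_mul]

theorem create_mul_createProd (u : EllTwo X) {n : ℕ} (v : Fin n → EllTwo X) :
    create u * createProd v = (-1 : ℂ) ^ n • (createProd v * create u) := by
  induction n with
  | zero => simp [createProd_zero]
  | succ n ih =>
    rw [createProd_succ, ← mul_assoc, eq_neg_of_add_eq_zero_left (create_anticomm u (v 0)),
      neg_mul, mul_assoc, ih, mul_smul_comm, pow_succ, mul_neg_one, neg_smul, mul_assoc]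

/-- This is the adjoint of moving `a(u)` through a product of creators, solved for the term with
`a*(u)` on the left. -/
theorem create_mul_star_createProd (u : EllTwo X) {n : ℕ} (v : Fin (n + 1) → EllTwo X) :
    create u * star (createProd v) = (-1 : ℂ) ^ n • ∑ j : Fin (n + 1),
      ((-1 : ℂ) ^ (j : ℕ) * inner ℂ (v j) u) • star (createProd fun i => v (j.succAbove i))
        - (-1 : ℂ) ^ n • (star (createProd v) * create u) := by
  have h := mul_prod_ofFn_of_anticomm (R := ℂ) (star (create u)) n (fun i => create (v i))
    (fun i => inner ℂ u (v i))
    (fun i => by rw [star_create_anticomm, Algebra.algebraMap_eq_smul_one])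
  have h' := congrArg star h
  change star (star (create u) * createProd v) = star (_ + (-1) ^ (n + 1) *
    (createProd v * star (create u))) at h'
  have hsmul : ((-1 : Fock X →L[ℂ] Fock X)) ^ (n + 1) * (createProd v * star (create u))
      = -((-1 : ℂ) ^ n • (createProd v * star (create u))) := by
    rw [Algebra.smul_def, map_pow, map_neg, map_one, pow_succ]; noncomm_ring
  rw [hsmul, star_add, star_mul, star_star, star_neg, star_smul, star_mul, star_star, star_sum] at h'
  have h1 : (-1 : ℂ) ^ n * (-1) ^ n = 1 := by rw [← mul_pow]; simp
  have h2 : star ((-1 : ℂ) ^ n) = (-1) ^ n := by simp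
  have h3 : ∀ j : Fin (n + 1), star (((-1 : ℂ) ^ (j : ℕ) * inner ℂ u (v j)) •
      (List.ofFn fun i => create (v (j.succAbove i))).prod)
      = ((-1 : ℂ) ^ (j : ℕ) * inner ℂ (v j) u) • star (createProd fun i => v (j.succAbove i)) := by
    intro j
    rw [star_smul, star_mul', ← inner_conj_symm (v j) u]
    simp only [star_pow, star_neg, star_one]
    rfl
  simp only [h3, h2] at h'
  rw [h', smul_add, smul_neg, smul_smul, h1, one_smul]
  abel

/-- The correlation functions of a vector annihilated by all `a*(P u)` and `a(u - P u)`. -/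
theorem inner_createProd_star_createProd {Ψ : Fock X} (h1 : ‖Ψ‖ = 1) (P : EllTwo X → EllTwo X)
    (hP : ∀ u, create (P u) Ψ = 0) (hP' : ∀ u, star (create (u - P u)) Ψ = 0) {n : ℕ}
    (f g : Fin n → EllTwo X) :
    inner ℂ Ψ (createProd f (star (createProd g) Ψ))
      = (Matrix.of fun i j => inner ℂ (g j) (P (f i)) : Matrix _ _ ℂ).det := by
  induction n with
  | zero =>
    rw [createProd_zero, createProd_zero, star_one]
    change inner ℂ Ψ Ψ = _
    rw [inner_self_eq_norm_sq_to_K, h1]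
    simp
  | succ n ih =>
    -- Passing the remaining `n` creators costs `(-1)^n`, which cancels the `(-1)^n` from passing
    -- the annihilators; the contractions form the first row of the determinant.
    have h2 : create (P (f 0)) * createProd (Fin.tail f) * star (createProd g)
        = (∑ j : Fin (n + 1), ((-1 : ℂ) ^ (j : ℕ) * inner ℂ (g j) (P (f 0))) •
            (createProd (Fin.tail f) * star (createProd fun i => g (j.succAbove i))))
          - createProd (Fin.tail f) * star (createProd g) * create (P (f 0)) := by
      have h3 : (-1 : ℂ) ^ n * (-1) ^ n = 1 := by rw [← mul_pow]; simp
      rw [create_mul_createProd, smul_mul_assoc, mul_assoc, create_mul_star_createProd, mul_sub,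
        mul_smul_comm, mul_smul_comm, smul_sub, smul_smul, smul_smul, h3, one_smul, one_smul,
        Finset.mul_sum, mul_assoc]
      simp only [mul_smul_comm]
    rw [createProd_succ f]
    change inner ℂ Ψ (create (f 0) (createProd (Fin.tail f) (star (createProd g) Ψ))) = _
    rw [inner_apply_of_star_sub (c := create (P (f 0))) (by rw [← map_sub]; exact hP' _)]
    have h4 := congrArg (fun T : Fock X →L[ℂ] Fock X => T Ψ) h2
    change create (P (f 0)) (createProd (Fin.tail f) (star (createProd g) Ψ))
      = (∑ j : Fin (n + 1), ((-1 : ℂ) ^ (j : ℕ) * inner ℂ (g j) (P (f 0))) •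
            (createProd (Fin.tail f) * star (createProd fun i => g (j.succAbove i)))) Ψ
        - createProd (Fin.tail f) (star (createProd g) (create (P (f 0)) Ψ)) at h4
    rw [h4, hP, map_zero, map_zero, sub_zero, sum_apply, inner_sum, Matrix.det_succ_row_zero]
    refine Finset.sum_congr rfl fun j _ => ?_
    rw [smul_apply, inner_smul_right]
    change _ * inner ℂ Ψ (createProd (Fin.tail f)
      (star (createProd fun i => g (j.succAbove i)) Ψ)) = _
    rw [ih]
    rfl

/-- Peeling off the outermost creator and the matching annihilator leaves the occupation number of
`x 0`: the two Jordan–Wigner signs are equal and multiply to `1`. -/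
theorem createProd_star_createProd_basisVec_apply {n : ℕ} {x : Fin n → X}
    (hx : Function.Injective x) (ψ : Fock X) (S : Finset X) :
    createProd (fun i => basisVec (x i)) (star (createProd fun i => basisVec (x i)) ψ) S
      = if ∀ i, x i ∈ S then ψ S else 0 := by
  induction n generalizing ψ S with
  | zero =>
    rw [createProd_zero, star_one]
    simp
  | succ n ih =>
    rw [star_createProd_succ, createProd_succ, create_basisVec]
    have hx' : Function.Injective fun i : Fin n => x i.succ :=
      fun i j h => Fin.succ_injective _ (hx h)
    change createSite (x 0) (createProd (fun i => basisVec (x i.succ))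
      (star (createProd fun i => basisVec (x i.succ)) (star (createSite (x 0)) ψ))) S = _
    rw [createSite_apply, ih hx', star_createSite_apply, toggle_toggle,
      jwSign_toggle_of_not_lt (lt_irrefl _)]
    have h1 : ∀ i : Fin n, x i.succ ∈ toggle (x 0) S ↔ x i.succ ∈ S :=
      fun i => mem_toggle_of_ne fun e => Fin.succ_ne_zero i (hx e)
    simp only [h1, Fin.forall_fin_succ, mem_toggle_self]
    have := jwSign_mul_self (x 0) S
    by_cases h0 : x 0 ∈ S <;> by_cases h2 : ∀ i : Fin n, x i.succ ∈ S <;>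
      simp [h0, h2, ← mul_assoc, this]

/-- The unit vector proportional to `a*(v₁) ⋯ a*(vₙ) Ω`. -/
noncomputable def slaterUnit {n : ℕ} (v : Fin n → EllTwo X) : Fock X :=
  ((‖slater v‖⁻¹ : ℝ) : ℂ) • slater v

section SlaterUnit

variable {n : ℕ} {v : Fin n → EllTwo X} (hv : LinearIndependent ℂ v)

include hv in
theorem norm_slaterUnit : ‖slaterUnit v‖ = 1 := by
  have := norm_pos_iff.2 (slater_ne_zero v hv)
  rw [slaterUnit, norm_smul, Complex.norm_real, norm_inv, norm_norm, inv_mul_cancel₀ this.ne']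

theorem slaterUnit_apply (S : Finset X) :
    slaterUnit v S = ((‖slater v‖⁻¹ : ℝ) : ℂ) * slater v S := rfl

theorem slaterUnit_apply_of_card_ne {S : Finset X} (h : S.card ≠ n) : slaterUnit v S = 0 := by
  rw [slaterUnit_apply, slater_apply_of_card_ne v h, mul_zero]

theorem slaterUnit_apply_nonneg (h : NonnegMinors v) (S : Finset X) : 0 ≤ slaterUnit v S := by
  rw [slaterUnit_apply]
  exact mul_nonneg (Complex.zero_le_real.2 (by positivity)) (slater_apply_nonneg h S)

theorem create_spanProj_slaterUnit (u : EllTwo X) : create (spanProj v u) (slaterUnit v) = 0 := by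
  rw [slaterUnit, map_smul, create_spanProj_slater, smul_zero]

theorem star_create_sub_spanProj_slaterUnit (u : EllTwo X) :
    star (create (u - spanProj v u)) (slaterUnit v) = 0 := by
  rw [slaterUnit, map_smul, star_create_sub_spanProj_slater, smul_zero]

include hv in
theorem isPolarized_slaterUnit :
    IsPolarized (fun f => fockRep (CAR.B (doubledInvolution X) f)) (slaterUnit v) :=
  isPolarized_fockRep (norm_slaterUnit hv) (spanProj v) create_spanProj_slaterUnit
    star_create_sub_spanProj_slaterUnit

include hv in
theorem tsum_norm_sq_slaterUnit {m : ℕ} {x : Fin m → X} (hx : Function.Injective x) :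
    ((∑' S : Finset X, if ∀ i, x i ∈ S then ‖slaterUnit v S‖ ^ 2 else 0 : ℝ) : ℂ)
      = (Matrix.of fun i j => spanKernel v (x i) (x j)).det := by
  have h := inner_createProd_star_createProd (norm_slaterUnit hv) (spanProj v)
    create_spanProj_slaterUnit star_create_sub_spanProj_slaterUnit
    (fun i => basisVec (x i)) (fun i => basisVec (x i))
  -- The correlation formula has entries `(g_j, P f_i)`, whereas the kernel has its row index in the
  -- left slot.
  rw [← Matrix.det_transpose] at h
  refine Eq.trans ?_ h
  rw [lp.inner_eq_tsum, Complex.ofReal_tsum]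
  refine tsum_congr fun S => ?_
  rw [createProd_star_createProd_basisVec_apply hx]
  split_ifs
  · rw [inner_self_eq_norm_sq_to_K]; push_cast; rfl
  · simp

end SlaterUnit

end Slater

/-! ## The point process of a vector of the Fock space -/

section PointProcess

open MeasureTheory

variable {X : Type*}

theorem measurableSet_apply_eq_true (x : X) : MeasurableSet {ω : Config X | ω x = true} :=
  measurableSet_eq_fun (measurable_pi_apply x) measurable_const

theorem measurableSet_occupied {n : ℕ} (x : Fin n → X) :
    MeasurableSet {ω : Config X | ∀ i, ω (x i) = true} := by
  rw [Set.ofPred_forall]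
  exact MeasurableSet.iInter fun i => measurableSet_apply_eq_true (x i)

/-- A determinantal point process is determined by its kernel. -/
theorem IsDPP.unique {M M' : Measure (Config X)} {K : X → X → ℂ} (h : IsDPP M K)
    (h' : IsDPP M' K) : M = M' := by
  classical
  have := h.1
  have := h'.1
  -- The events "all of `F` is occupied" are closed under intersection, via `F ∪ G`, and generate
  -- the product `σ`-algebra; the kernel prescribes their probabilities.
  refine ext_of_generate_finite
    (Set.range fun F : Finset X => {ω : Config X | ∀ x ∈ F, ω x = true}) ?_ ?_ ?_ (by simp)
  · refine le_antisymm (iSup_le fun x => ?_) (MeasurableSpace.generateFrom_le ?_)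
    · refine measurable_iff_comap_le.1 (measurable_to_bool ?_)
      exact MeasurableSpace.measurableSet_generateFrom ⟨{x}, by ext ω; simp⟩
    · rintro _ ⟨F, rfl⟩
      simp only [Set.ofPred_forall]
      exact Finset.measurableSet_biInter F fun x _ => measurableSet_apply_eq_true x
  · rintro _ ⟨F, rfl⟩ _ ⟨G, rfl⟩ -
    refine ⟨F ∪ G, ?_⟩
    ext ω
    simp only [Finset.mem_union, Set.mem_ofPred_eq, Set.mem_inter_iff, or_imp, forall_and]
  · rintro _ ⟨F, rfl⟩
    set x : Fin F.card → X := fun i => F.equivFin.symm i with hx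
    have hinj : Function.Injective x := Subtype.val_injective.comp F.equivFin.symm.injective
    have hset : {ω : Config X | ∀ y ∈ F, ω y = true} = {ω | ∀ i, ω (x i) = true} := by
      ext ω
      simp only [Set.mem_ofPred_eq, hx]
      refine ⟨fun h i => h _ (F.equivFin.symm i).2, fun h y hy => ?_⟩
      simpa using h (F.equivFin ⟨y, hy⟩)
    have e : M.real {ω | ∀ i, ω (x i) = true} = M'.real {ω | ∀ i, ω (x i) = true} :=
      Complex.ofReal_injective ((h.2 _ x hinj).trans (h'.2 _ x hinj).symm)
    simp only [hset]
    exact (measureReal_eq_measureReal_iff).1 e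

open scoped Classical in
/-- The configuration with the finite set `S` of occupied points. -/
noncomputable def configOf (S : Finset X) : Config X := fun x => decide (x ∈ S)

theorem configOf_apply {S : Finset X} {x : X} : configOf S x = true ↔ x ∈ S := by
  simp [configOf]

theorem configOf_injective : Function.Injective (configOf : Finset X → Config X) := by
  intro S T h
  ext x
  rw [← configOf_apply, h, configOf_apply]

theorem permute_configOf (g : Equiv.Perm X) (S : Finset X) :
    permute g (configOf S) = configOf (S.map g.toEmbedding) := by
  ext x
  rw [permute, Bool.eq_iff_iff, configOf_apply, configOf_apply, Finset.mem_map_equiv]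
  rfl

theorem measurable_permute (g : Equiv.Perm X) : Measurable (permute g : Config X → Config X) :=
  measurable_pi_lambda _ fun _ => measurable_pi_apply _

theorem permute_injective (g : Equiv.Perm X) :
    Function.Injective (permute g : Config X → Config X) := by
  intro ω ω' h
  ext x
  have := congrFun h (g x)
  simpa [permute] using this

/-- The law of the random finite set with the amplitudes `ψ`. -/
noncomputable def fockMeasure (ψ : Fock X) : Measure (Config X) :=
  Measure.sum fun S => (‖ψ S‖ₑ ^ 2) • Measure.dirac (configOf S)

theorem fockMeasure_apply (ψ : Fock X) {s : Set (Config X)} (hs : MeasurableSet s) :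
    fockMeasure ψ s = ∑' S, ‖ψ S‖ₑ ^ 2 * s.indicator 1 (configOf S) := by
  rw [fockMeasure, Measure.sum_apply _ hs]
  refine tsum_congr fun S => ?_
  rw [Measure.smul_apply, Measure.dirac_apply' _ hs, smul_eq_mul]

theorem fockMeasure_real_occupied (ψ : Fock X) {n : ℕ} (x : Fin n → X)
    [∀ S : Finset X, Decidable (∀ i, x i ∈ S)] :
    (fockMeasure ψ).real {ω | ∀ i, ω (x i) = true}
      = ∑' S : Finset X, if ∀ i, x i ∈ S then ‖ψ S‖ ^ 2 else 0 := by
  rw [Measure.real, fockMeasure_apply ψ (measurableSet_occupied x), ENNReal.tsum_toReal_eq]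
  · refine tsum_congr fun S => ?_
    simp only [Set.indicator_apply, Set.mem_ofPred_eq, configOf_apply]
    split_ifs <;> simp
  · intro S
    refine ENNReal.mul_ne_top (by simp) ?_
    rw [Set.indicator_apply]
    split_ifs <;> simp

theorem isProbabilityMeasure_fockMeasure {ψ : Fock X} (h : ‖ψ‖ = 1) :
    IsProbabilityMeasure (fockMeasure ψ) := by
  classical
  -- With no points prescribed, the occupation event is the whole space and the sum is `‖ψ‖²`.
  have h1 := fockMeasure_real_occupied ψ (Fin.elim0 : Fin 0 → X)
  have h2 : {ω : Config X | ∀ i : Fin 0, ω (Fin.elim0 i) = true} = Set.univ := by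
    ext ω; simp
  rw [h2] at h1
  simp only [IsEmpty.forall_iff, if_true] at h1
  rw [(EllTwo.hasSum_norm_sq ψ).tsum_eq, h, one_pow] at h1
  refine ⟨?_⟩
  rwa [Measure.real, ENNReal.toReal_eq_one_iff] at h1

theorem isDPP_fockMeasure_slaterUnit [LinearOrder X] {n : ℕ} {v : Fin n → EllTwo X}
    (hv : LinearIndependent ℂ v) : IsDPP (fockMeasure (slaterUnit v)) (spanKernel v) :=
  ⟨isProbabilityMeasure_fockMeasure (norm_slaterUnit hv), fun m x hx => by
    rw [fockMeasure_real_occupied, tsum_norm_sq_slaterUnit hv hx]⟩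

theorem lintegral_fockMeasure [Countable X] (ψ : Fock X) (f : Config X → ENNReal) :
    ∫⁻ ω, f ω ∂fockMeasure ψ = ∑' S, ‖ψ S‖ₑ ^ 2 * f (configOf S) := by
  rw [fockMeasure, lintegral_sum_measure]
  refine tsum_congr fun S => ?_
  rw [lintegral_smul_measure, lintegral_dirac, smul_eq_mul]

/-- The measure is purely atomic. Countability of `X` makes singletons measurable, so `p` need not
be. -/
theorem ae_fockMeasure_iff [Countable X] (ψ : Fock X) {p : Config X → Prop} :
    (∀ᵐ ω ∂fockMeasure ψ, p ω) ↔ ∀ S, ψ S ≠ 0 → p (configOf S) := by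
  rw [fockMeasure, Measure.ae_sum_iff]
  refine forall_congr' fun S => ?_
  by_cases h : ψ S = 0
  · simp [h]
  · rw [Measure.ae_ennreal_smul_measure_iff (by simpa using h), ae_dirac_eq]
    simp [h]

theorem fockMeasure_eq_zero_iff [Countable X] (ψ : Fock X) {s : Set (Config X)} :
    fockMeasure ψ s = 0 ↔ ∀ S, ψ S ≠ 0 → configOf S ∉ s := by
  rw [measure_eq_zero_iff_ae_notMem, ae_fockMeasure_iff]

theorem fockMeasure_singleton [Countable X] (ψ : Fock X) (S : Finset X) :
    fockMeasure ψ {configOf S} = ‖ψ S‖ₑ ^ 2 := by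
  classical
  rw [fockMeasure_apply ψ (measurableSet_singleton _), tsum_eq_single S]
  · simp
  · intro T hT
    rw [Set.indicator_of_notMem (by simpa using configOf_injective.ne hT), mul_zero]

theorem map_permute_singleton [Countable X] (ψ : Fock X) (g : Equiv.Perm X) (S : Finset X) :
    (fockMeasure ψ).map (permute g) {configOf S} = ‖ψ (S.map (g⁻¹).toEmbedding)‖ₑ ^ 2 := by
  rw [Measure.map_apply (measurable_permute g) (measurableSet_singleton _),
    ← fockMeasure_singleton]
  congr 1
  have : configOf S = permute g (configOf (S.map (g⁻¹).toEmbedding)) := by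
    rw [permute_configOf, Finset.map_map]
    congr 1
    ext x
    simp
  rw [this]
  ext ω
  simp [(permute_injective g).eq_iff]

/-- A property of finite sets that is invariant under transpositions only depends on the
cardinality. -/
theorem Finset.induction_swap [DecidableEq X] {P : Finset X → Prop}
    (hP : ∀ x y S, P S → P (S.map (Equiv.swap x y).toEmbedding)) {S T : Finset X}
    (hcard : S.card = T.card) (hS : P S) : P T := by
  obtain ⟨k, hk⟩ : ∃ k, (S \ T).card = k := ⟨_, rfl⟩
  induction k generalizing S with
  | zero =>
    rw [Finset.card_eq_zero, Finset.sdiff_eq_empty_iff_subset] at hk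
    rwa [← Finset.eq_of_subset_of_card_le hk hcard.ge]
  | succ k ih =>
    obtain ⟨x, hx⟩ : (S \ T).Nonempty := Finset.card_pos.1 (by omega)
    obtain ⟨y, hy⟩ : (T \ S).Nonempty := Finset.card_pos.1 (by
      have h1 := Finset.card_sdiff_add_card_inter S T
      have h2 := Finset.card_sdiff_add_card_inter T S
      rw [Finset.inter_comm] at h2
      omega)
    rw [Finset.mem_sdiff] at hx hy
    refine ih (S := S.map (Equiv.swap x y).toEmbedding) (by rw [Finset.card_map, hcard])
      (hP x y S hS) ?_
    -- Exchanging a point of `S \ T` with one of `T \ S` removes exactly one point from the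
    -- difference.
    have h : S.map (Equiv.swap x y).toEmbedding \ T = (S \ T).erase x := by
      ext z
      rw [Finset.mem_sdiff, Finset.mem_map_equiv, Equiv.symm_swap, Finset.mem_erase,
        Finset.mem_sdiff]
      by_cases hzx : z = x
      · subst hzx; simp [hy.2]
      · by_cases hzy : z = y
        · subst hzy; simp [hy.1]
        · simp [Equiv.swap_apply_of_ne_of_ne hzx hzy, hzx]
    rw [h, Finset.card_erase_of_mem (Finset.mem_sdiff.2 hx), hk]
    rfl

theorem finite_support_swap [DecidableEq X] (x y : X) :
    {z | Equiv.swap x y z ≠ z}.Finite := by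
  refine (Set.toFinite {x, y}).subset fun z hz => ?_
  by_contra h
  simp only [Set.mem_insert_iff, Set.mem_singleton_iff, not_or] at h
  exact hz (Equiv.swap_apply_of_ne_of_ne h.1 h.2)

/-- If `ψ` vanished at the image of `R` under a transposition, that atom would be null, hence by
quasi-invariance so would the atom at `R`. Transpositions connect all sets of the same cardinality.
-/
theorem ne_zero_of_isQuasiInvariant [Countable X] {ψ : Fock X} {n : ℕ} (hψ : ψ ≠ 0)
    (hcard : ∀ S, S.card ≠ n → ψ S = 0) (hq : IsQuasiInvariant (fockMeasure ψ)) {S : Finset X}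
    (hS : S.card = n) : ψ S ≠ 0 := by
  classical
  obtain ⟨T, hT⟩ : ∃ T, ψ T ≠ 0 := by
    by_contra! h
    exact hψ (by ext T; exact h T)
  have hTn : T.card = n := by
    by_contra h
    exact hT (hcard T h)
  refine Finset.induction_swap (P := fun S => ψ S ≠ 0) ?_ (hTn.trans hS.symm) hT
  intro x y R hR h0
  have h1 : fockMeasure ψ {configOf (R.map (Equiv.swap x y).toEmbedding)} = 0 := by
    rw [fockMeasure_singleton, h0]; simp
  have h2 := (hq _ (finite_support_swap x y)).2 h1
  rw [map_permute_singleton, Finset.map_map] at h2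
  have h3 : (Equiv.swap x y).toEmbedding.trans (Equiv.swap x y)⁻¹.toEmbedding
      = Function.Embedding.refl X := by
    ext z; simp
  rw [h3, Finset.map_refl] at h2
  simp [hR] at h2

/-- The null sets are those containing no configuration with `n` points, a condition stable under
permutations. -/
theorem isQuasiInvariant_fockMeasure [Countable X] {ψ : Fock X} {n : ℕ}
    (hcard : ∀ S, ψ S ≠ 0 ↔ S.card = n) : IsQuasiInvariant (fockMeasure ψ) := by
  intro g _
  have key : ∀ s, MeasurableSet s →
      ((fockMeasure ψ).map (permute g) s = 0 ↔ fockMeasure ψ s = 0) := by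
    intro s hs
    rw [Measure.map_apply (measurable_permute g) hs, fockMeasure_eq_zero_iff,
      fockMeasure_eq_zero_iff]
    simp only [hcard, Set.mem_preimage, permute_configOf]
    constructor
    · intro h S hS
      have := h (S.map (g⁻¹).toEmbedding) (by rw [Finset.card_map, hS])
      rw [Finset.map_map] at this
      have h3 : (g⁻¹).toEmbedding.trans g.toEmbedding = Function.Embedding.refl X := by
        ext z; simp
      rwa [h3, Finset.map_refl] at this
    · intro h S hS
      exact h _ (by rw [Finset.card_map, hS])
  exact ⟨Measure.AbsolutelyContinuous.mk fun s hs h => (key s hs).1 h,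
    Measure.AbsolutelyContinuous.mk fun s hs h => (key s hs).2 h⟩

end PointProcess

/-! ## The representation of the gauge-invariant algebra on `L²` of the point process -/

section Compression

variable {A : Type*} [CStarAlgebra A] {L H : Type*} [NormedAddCommGroup L] [InnerProductSpace ℂ L]
  [CompleteSpace L] [NormedAddCommGroup H] [InnerProductSpace ℂ H] [CompleteSpace H]
  (U : L →ₗᵢ[ℂ] H)

/-- The adjoint of an isometry. -/
noncomputable def isometryAdjoint : H →L[ℂ] L :=
  ContinuousLinearMap.adjoint U.toContinuousLinearMap

theorem isometryAdjoint_apply (l : L) : isometryAdjoint U (U l) = l := by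
  refine ext_inner_left ℂ fun k => ?_
  rw [isometryAdjoint, ContinuousLinearMap.adjoint_inner_right]
  exact U.inner_map_map k l

variable {D : StarSubalgebra ℂ A} (π : D →⋆ₐ[ℂ] (H →L[ℂ] H))
  (hD : ∀ a l, ∃ l', π a (U l) = U l')

include hD in
-- `U U*` fixes the range of `U`, and `hD` keeps `π a (U l)` in it. This is what makes the
-- compression multiplicative.
theorem apply_isometryAdjoint (a : D) (l : L) :
    U (isometryAdjoint U (π a (U l))) = π a (U l) := by
  obtain ⟨l', hl'⟩ := hD a l
  rw [hl', isometryAdjoint_apply]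

/-- The subrepresentation on the range of an isometry. -/
noncomputable def compression : D →⋆ₐ[ℂ] (L →L[ℂ] L) where
  toFun a := isometryAdjoint U ∘L π a ∘L U.toContinuousLinearMap
  map_one' := by
    refine ContinuousLinearMap.ext fun l => ?_
    rw [map_one]
    exact isometryAdjoint_apply U l
  map_mul' a b := by
    refine ContinuousLinearMap.ext fun l => ?_
    rw [map_mul]
    change isometryAdjoint U (π a (π b (U l)))
      = isometryAdjoint U (π a (U (isometryAdjoint U (π b (U l)))))
    rw [apply_isometryAdjoint U π hD]
  map_zero' := by
    rw [map_zero, ContinuousLinearMap.zero_comp, ContinuousLinearMap.comp_zero]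
  map_add' a b := by
    rw [map_add, ContinuousLinearMap.add_comp, ContinuousLinearMap.comp_add]
  commutes' c := by
    refine ContinuousLinearMap.ext fun l => ?_
    rw [Algebra.algebraMap_eq_smul_one, map_smul, map_one, Algebra.algebraMap_eq_smul_one]
    change isometryAdjoint U (c • U l) = c • l
    rw [map_smul, isometryAdjoint_apply]
  map_star' a := by
    rw [map_star, ContinuousLinearMap.star_eq_adjoint, ContinuousLinearMap.star_eq_adjoint,
      ContinuousLinearMap.adjoint_comp, ContinuousLinearMap.adjoint_comp, isometryAdjoint,
      ContinuousLinearMap.adjoint_adjoint, ContinuousLinearMap.comp_assoc]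

theorem isometry_compression_apply (a : D) (l : L) :
    U (compression U π hD a l) = π a (U l) :=
  apply_isometryAdjoint U π hD a l

end Compression

/-! ### Action of the gauge-invariant algebra on Fock space -/

section GaugeRep

variable {X : Type*} [LinearOrder X]

/-- The Fock representation of the gauge-invariant algebra. -/
noncomputable def gaugeRep : GaugeInvariant X →⋆ₐ[ℂ] (Fock X →L[ℂ] Fock X) :=
  fockRep.comp (GaugeInvariant X).subtype

theorem gaugeRep_apply (a : GaugeInvariant X) : gaugeRep a = fockRep (a : CARAlgebra X) := rfl

theorem gaugeRep_hop (x y : X) : gaugeRep (hop x y) = createSite x * star (createSite y) := by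
  rw [gaugeRep_apply, hop, map_mul, map_star, fockRep_annih, fockRep_annih, star_star]

theorem gaugeRep_eta_apply (x : X) (ψ : Fock X) (S : Finset X) :
    gaugeRep (eta x) ψ S = (if x ∈ S then -1 else 1) * ψ S := by
  rw [eta, map_sub, map_one, map_smul, gaugeRep_hop]
  change ψ S - 2 * createSite x (star (createSite x) ψ) S = _
  rw [createSite_apply, star_createSite_apply, toggle_toggle,
    jwSign_toggle_of_not_lt (lt_irrefl x)]
  have := jwSign_mul_self x S
  by_cases h : x ∈ S
  · simp only [h, if_true, mem_toggle_self, not_true_eq_false, if_false, ← mul_assoc, this]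
    ring
  · simp [h]

theorem gaugeRep_prod_eta_apply (l : List X) (ψ : Fock X) (S : Finset X) :
    gaugeRep (l.map eta).prod ψ S = (l.map fun z => if z ∈ S then (-1 : ℂ) else 1).prod * ψ S := by
  induction l with
  | nil => simp
  | cons x l ih =>
    rw [List.map_cons, List.prod_cons, List.map_cons, List.prod_cons, map_mul]
    change gaugeRep (eta x) (gaugeRep (l.map eta).prod ψ) S = _
    rw [gaugeRep_eta_apply, ih, mul_assoc]

/-- The sign of the points of `S` strictly between `x` and `y`. -/
def betweenSign (x y : X) (S : Finset X) : ℂ := (-1) ^ (S.filter fun z => x < z ∧ z < y).card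

theorem gaugeRep_etaBetween_apply [LocallyFiniteOrder X] (x y : X) (ψ : Fock X) (S : Finset X) :
    gaugeRep (etaBetween x y) ψ S = betweenSign x y S * ψ S := by
  rw [etaBetween, gaugeRep_prod_eta_apply]
  congr 1
  have h : ∀ (F : Finset X) (f : X → ℂ), (F.sort.map f).prod = ∏ z ∈ F, f z := by
    intro F f
    rw [Finset.prod_eq_multiset_prod, ← Finset.sort_eq F (· ≤ ·), Multiset.map_coe,
      Multiset.prod_coe]
  rw [h, Finset.prod_ite, Finset.prod_const, Finset.prod_const_one, mul_one, betweenSign]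
  congr 2
  ext z
  simp [and_comm, and_assoc]

/-- The points above `x` are those between `x` and `y`, possibly `y`, and those above `y`. -/
theorem jwSign_eq_betweenSign_mul {x y : X} (h : x < y) (S : Finset X) :
    jwSign x S = betweenSign x y S * (if y ∈ S then -1 else 1) * jwSign y S := by
  have h1 : S.filter (x < ·) = (S.filter fun z => x < z ∧ z < y)
      ∪ ((S.filter (· = y)) ∪ S.filter (y < ·)) := by
    ext z
    simp only [Finset.mem_filter, Finset.mem_union]
    constructor
    · rintro ⟨hz, hx⟩
      rcases lt_trichotomy z y with h' | h' | h'
      · exact Or.inl ⟨hz, hx, h'⟩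
      · exact Or.inr (Or.inl ⟨hz, h'⟩)
      · exact Or.inr (Or.inr ⟨hz, h'⟩)
    · rintro (⟨hz, hx, -⟩ | ⟨hz, rfl⟩ | ⟨hz, hy⟩)
      · exact ⟨hz, hx⟩
      · exact ⟨hz, h⟩
      · exact ⟨hz, h.trans hy⟩
  have h2 : (S.filter (x < ·)).card = (S.filter fun z => x < z ∧ z < y).card
      + ((S.filter (· = y)).card + (S.filter (y < ·)).card) := by
    rw [h1, Finset.card_union_of_disjoint, Finset.card_union_of_disjoint]
    · rw [Finset.disjoint_filter]
      rintro z - rfl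
      exact lt_irrefl _
    · rw [Finset.disjoint_union_right, Finset.disjoint_filter, Finset.disjoint_filter]
      exact ⟨fun z _ hz => hz.2.ne, fun z _ hz => hz.2.not_gt⟩
  rw [jwSign, jwSign, betweenSign, h2, pow_add, pow_add, Finset.filter_eq']
  by_cases hy : y ∈ S <;> simp [hy]

theorem map_swap_of_iff {x y : X} {S : Finset X} (h : x ∈ S ↔ y ∈ S) :
    S.map (Equiv.swap x y).toEmbedding = S := by
  ext z
  rw [Finset.mem_map_equiv, Equiv.symm_swap, Equiv.swap_apply_def]
  split_ifs with h1 h2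
  · rw [h1, h]
  · rw [h2, h]
  · rfl

theorem map_swap_of_not_iff {x y : X} {S : Finset X} (h : ¬ (x ∈ S ↔ y ∈ S)) :
    S.map (Equiv.swap x y).toEmbedding = toggle y (toggle x S) := by
  ext z
  rw [Finset.mem_map_equiv, Equiv.symm_swap, Equiv.swap_apply_def]
  have hxy : x ≠ y := by rintro rfl; exact h Iff.rfl
  split_ifs with h1 h2
  · subst h1; rw [mem_toggle_of_ne hxy, mem_toggle_self]; tauto
  · subst h2; rw [mem_toggle_self, mem_toggle_of_ne hxy.symm]; tauto
  · rw [mem_toggle_of_ne h2, mem_toggle_of_ne h1]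

/-- If `x` and `y` are equally occupied in `S`, then `η_x η_y` acts as `1` at `S` and the hopping
term vanishes there. Otherwise `η_x η_y` acts as `-1`: only `η_(x,y)` times the hop survives, and
the two copies of `betweenSign` cancel. -/
theorem gaugeRep_swapElt_apply [LocallyFiniteOrder X] {x y : X} (h : x < y) (ψ : Fock X)
    (S : Finset X) :
    gaugeRep (swapElt x y) ψ S = ψ (S.map (Equiv.swap x y).toEmbedding) := by
  have hhop : gaugeRep (hop x y + hop y x) ψ S
      = (if x ∈ S ∧ y ∉ S ∨ y ∈ S ∧ x ∉ S then betweenSign x y S else 0)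
        * ψ (toggle y (toggle x S)) := by
    rw [map_add, gaugeRep_hop, gaugeRep_hop]
    change createSite x (star (createSite y) ψ) S + createSite y (star (createSite x) ψ) S = _
    simp only [createSite_apply, star_createSite_apply, mem_toggle_of_ne h.ne,
      mem_toggle_of_ne h.ne', jwSign_toggle_of_lt h, jwSign_toggle_of_not_lt h.not_gt,
      toggle_comm x y]
    have h1 := jwSign_mul_self y S
    have h2 := jwSign_eq_betweenSign_mul h S
    by_cases hx : x ∈ S <;> by_cases hy : y ∈ S <;> simp only [hx, hy, if_true, if_false] at h2 ⊢
    · simp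
    · simp only [not_false_eq_true, and_self, true_or, if_true, add_zero]
      rw [h2]
      linear_combination (betweenSign x y S * ψ (toggle y (toggle x S))) * h1
    · simp only [not_false_eq_true, and_self, or_true, if_true, zero_add]
      rw [h2]
      linear_combination (betweenSign x y S * ψ (toggle y (toggle x S))) * h1
    · simp
  set φ := gaugeRep (hop x y + hop y x) ψ with hφ
  have hηη : ∀ φ : Fock X, gaugeRep (eta x * eta y) φ S
      = (if x ∈ S then -1 else 1) * ((if y ∈ S then -1 else 1) * φ S) := by
    intro φ
    rw [map_mul]
    change gaugeRep (eta x) (gaugeRep (eta y) φ) S = _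
    rw [gaugeRep_eta_apply, gaugeRep_eta_apply]
  have e : gaugeRep (swapElt x y) ψ S
      = (1 / 2 : ℂ) * (ψ S + gaugeRep (eta x * eta y) ψ S)
        + (1 / 2 : ℂ) * (φ S + gaugeRep (eta x * eta y) φ S
          + (gaugeRep (etaBetween x y) φ S
            - gaugeRep (eta x * eta y) (gaugeRep (etaBetween x y) φ) S)) := by
    rw [swapElt, map_add, map_smul, map_mul, map_smul, map_add, map_add, map_add, map_mul _ (1 - _),
      map_sub, map_one]
    rfl
  have hs : betweenSign x y S * betweenSign x y S = 1 := by
    rw [betweenSign, ← mul_pow]; simp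
  rw [e, hηη, hηη, hηη, gaugeRep_etaBetween_apply, hhop]
  by_cases hx : x ∈ S <;> by_cases hy : y ∈ S
  · rw [map_swap_of_iff (by tauto)]
    simp only [hx, hy, if_true, not_true_eq_false, and_false, or_self, if_false]
    ring
  · rw [map_swap_of_not_iff (by tauto)]
    simp only [hx, hy, if_true, if_false, not_false_eq_true, and_self, true_or]
    linear_combination ψ (toggle y (toggle x S)) * hs
  · rw [map_swap_of_not_iff (by tauto)]
    simp only [hx, hy, if_true, if_false, not_false_eq_true, and_self, or_true]
    linear_combination ψ (toggle y (toggle x S)) * hs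
  · rw [map_swap_of_iff (by tauto)]
    simp only [hx, hy, if_false, false_and, or_self]
    ring

/-- The gauge-invariant algebra preserves the number of particles. -/
theorem gaugeRep_apply_eq_zero {n : ℕ} (a : GaugeInvariant X) {ψ : Fock X}
    (hψ : ∀ S, S.card ≠ n → ψ S = 0) {S : Finset X} (hS : S.card ≠ n) : gaugeRep a ψ S = 0 := by
  -- The claim is proved for `a` and `star a` together, so that the induction passes through the
  -- star.
  have key : ∀ a ∈ StarAlgebra.adjoin ℂ
      {A : CARAlgebra X | ∃ x y : X, A = star (annih x) * annih y},
      (∀ ψ : Fock X, (∀ S, S.card ≠ n → ψ S = 0) → ∀ S, S.card ≠ n → fockRep a ψ S = 0) ∧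
      (∀ ψ : Fock X, (∀ S, S.card ≠ n → ψ S = 0) → ∀ S, S.card ≠ n →
        fockRep (star a) ψ S = 0) := by
    intro a ha
    induction ha using StarAlgebra.adjoin_induction with
    | mem a ha =>
      obtain ⟨x, y, rfl⟩ := ha
      have hop_eq : ∀ (x y : X) (ψ : Fock X), (∀ S, S.card ≠ n → ψ S = 0) →
          ∀ S, S.card ≠ n → fockRep (star (annih x) * annih y) ψ S = 0 := by
        intro x y ψ hψ S hS
        rw [map_mul, map_star, fockRep_annih, fockRep_annih, star_star]
        change createSite x (star (createSite y) ψ) S = 0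
        rw [createSite_apply, star_createSite_apply]
        split_ifs with h1 h2
        · rw [mul_zero]
        · rw [hψ, mul_zero, mul_zero]
          rw [toggle_of_notMem h2, Finset.card_insert_of_notMem h2, toggle_of_mem h1,
            Finset.card_erase_add_one h1]
          exact hS
        · rfl
      refine ⟨hop_eq x y, ?_⟩
      rw [star_mul, star_star]
      exact hop_eq y x
    | algebraMap c =>
      have h : ∀ (c : ℂ) (ψ : Fock X), (∀ S, S.card ≠ n → ψ S = 0) →
          ∀ S, S.card ≠ n → fockRep (algebraMap ℂ (CARAlgebra X) c) ψ S = 0 := by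
        intro c ψ hψ S hS
        rw [Algebra.algebraMap_eq_smul_one, map_smul, map_one]
        change c * ψ S = 0
        rw [hψ S hS, mul_zero]
      refine ⟨h c, ?_⟩
      rw [← algebraMap_star_comm]
      exact h _
    | add a b _ _ ha hb =>
      refine ⟨fun ψ hψ S hS => ?_, fun ψ hψ S hS => ?_⟩
      · rw [map_add]
        change fockRep a ψ S + fockRep b ψ S = 0
        rw [ha.1 ψ hψ S hS, hb.1 ψ hψ S hS, add_zero]
      · rw [star_add, map_add]
        change fockRep (star a) ψ S + fockRep (star b) ψ S = 0
        rw [ha.2 ψ hψ S hS, hb.2 ψ hψ S hS, add_zero]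
    | mul a b _ _ ha hb =>
      refine ⟨fun ψ hψ S hS => ?_, fun ψ hψ S hS => ?_⟩
      · rw [map_mul]
        exact ha.1 _ (hb.1 ψ hψ) S hS
      · rw [star_mul, map_mul]
        exact hb.2 _ (ha.2 ψ hψ) S hS
    | star a _ ha => exact ⟨ha.2, by rw [star_star]; exact ha.1⟩
  -- A fixed coefficient of `a ψ` is continuous in `a`, so the vanishing extends to the closure.
  have hcl : IsClosed {a : CARAlgebra X | fockRep a ψ S = 0} := by
    refine isClosed_eq ?_ continuous_const
    have h1 : Continuous fun a : CARAlgebra X => fockRep a ψ :=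
      (ContinuousLinearMap.apply ℂ (Fock X) ψ).continuous.comp
        (StarAlgHom.toCLM (fockRep (X := X))).continuous
    exact (continuous_ellTwo_apply S).comp h1
  exact closure_minimal (fun a ha => (key a ha).1 ψ hψ S hS) hcl a.2

end GaugeRep

/-! ### The isometry of `L²(M)` into Fock space, and perfectness -/

section LTwo

open MeasureTheory

/-- A sequence whose square sum is known in `[0, ∞]`. -/
theorem hasSum_norm_sq_of_tsum_enorm {ι E F : Type*} [NormedAddCommGroup E]
    [NormedAddCommGroup F] {a : ι → E} {x : F} (h : ∑' i, ‖a i‖ₑ ^ 2 = ‖x‖ₑ ^ 2) :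
    HasSum (fun i => ‖a i‖ ^ 2) (‖x‖ ^ 2) := by
  have h1 := ENNReal.hasSum_toReal (f := fun i => ‖a i‖ₑ ^ 2) (by rw [h]; simp)
  rw [← ENNReal.tsum_toReal_eq (by simp), h] at h1
  simpa using h1

theorem EllTwo.tsum_enorm_sq_ne_top {ι : Type*} (g : EllTwo ι) : ∑' i, ‖g i‖ₑ ^ 2 ≠ ⊤ := by
  have h := (EllTwo.hasSum_norm_sq g).summable
  have h1 : ∀ i, ‖g i‖ₑ ^ 2 = ENNReal.ofReal (‖g i‖ ^ 2) := fun i => by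
    rw [ENNReal.ofReal_pow (norm_nonneg _), ofReal_norm]
  simp only [h1]
  rw [← ENNReal.ofReal_tsum_of_nonneg (fun _ => by positivity) h]
  exact ENNReal.ofReal_ne_top

theorem eLpNorm_two_sq {α : Type*} [MeasurableSpace α] {μ : Measure α} (f : α → ℂ) :
    eLpNorm f 2 μ ^ 2 = ∫⁻ x, ‖f x‖ₑ ^ 2 ∂μ := by
  have := eLpNorm_nnreal_pow_eq_lintegral (μ := μ) (f := f) (p := 2) two_ne_zero
  simpa using this

variable {X : Type*} [Countable X] (ψ : Fock X)

theorem tsum_enorm_sq_mul (h : Lp ℂ 2 (fockMeasure ψ)) :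
    ∑' S, ‖ψ S * h (configOf S)‖ₑ ^ 2 = ‖h‖ₑ ^ 2 := by
  rw [Lp.enorm_def, eLpNorm_two_sq, lintegral_fockMeasure]
  refine tsum_congr fun S => ?_
  rw [enorm_mul, mul_pow]

/-- Two representatives of an `L²` class can differ at `configOf S` only where `ψ S = 0`; the
isometry is thus independent of the representative. -/
theorem mul_apply_configOf_congr {f g : Config X → ℂ} (h : f =ᵐ[fockMeasure ψ] g) (S : Finset X) :
    ψ S * f (configOf S) = ψ S * g (configOf S) := by
  by_cases h0 : ψ S = 0
  · rw [h0, zero_mul, zero_mul]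
  · rw [(ae_fockMeasure_iff ψ).1 h S h0]

/-- The isometry `h ↦ (ψ(S) h(S))_S` of `L²` of the point process into the Fock space. -/
noncomputable def fockIsometry : Lp ℂ 2 (fockMeasure ψ) →ₗᵢ[ℂ] Fock X where
  toFun h := ⟨fun S => ψ S * h (configOf S),
    EllTwo.memℓp_of_summable (hasSum_norm_sq_of_tsum_enorm (tsum_enorm_sq_mul ψ h)).summable⟩
  map_add' h k := by
    ext S
    refine (mul_apply_configOf_congr ψ (Lp.coeFn_add h k) S).trans ?_
    exact mul_add _ _ _
  map_smul' c h := by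
    ext S
    refine (mul_apply_configOf_congr ψ (Lp.coeFn_smul c h) S).trans ?_
    exact mul_left_comm _ _ _
  norm_map' h := by
    refine (sq_eq_sq₀ (norm_nonneg _) (norm_nonneg _)).1 ?_
    exact (EllTwo.hasSum_norm_sq _).unique (hasSum_norm_sq_of_tsum_enorm (tsum_enorm_sq_mul ψ h))

theorem fockIsometry_apply (h : Lp ℂ 2 (fockMeasure ψ)) (S : Finset X) :
    fockIsometry ψ h S = ψ S * h (configOf S) := rfl

/-- A preimage is `g / ψ` on the finite configurations and `0` elsewhere. So the range consists of
all vectors supported where `ψ` is nonzero. -/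
theorem exists_fockIsometry_eq {g : Fock X} (hg : ∀ S, ψ S = 0 → g S = 0) :
    ∃ h, fockIsometry ψ h = g := by
  set f : Config X → ℂ := Function.extend configOf (fun S => g S / ψ S) 0 with hf
  have hfS : ∀ S, f (configOf S) = g S / ψ S := fun S => configOf_injective.extend_apply _ _ S
  have hmul : ∀ S, ψ S * f (configOf S) = g S := by
    intro S
    rw [hfS]
    by_cases h0 : ψ S = 0
    · rw [h0, zero_mul, hg S h0]
    · rw [mul_div_cancel₀ _ h0]
  have hmem : MemLp f 2 (fockMeasure ψ) := by
    refine ⟨AEStronglyMeasurable.sum_measure fun S =>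
      aestronglyMeasurable_dirac.smul_measure _, ?_⟩
    have h1 : eLpNorm f 2 (fockMeasure ψ) ^ 2 ≠ ⊤ := by
      rw [eLpNorm_two_sq, lintegral_fockMeasure]
      convert EllTwo.tsum_enorm_sq_ne_top g using 3 with S
      rw [← hmul S, enorm_mul, mul_pow]
    rw [lt_top_iff_ne_top]
    intro h2
    rw [h2] at h1
    simp at h1
  refine ⟨hmem.toLp f, ?_⟩
  ext S
  rw [fockIsometry_apply, mul_apply_configOf_congr ψ hmem.coeFn_toLp, hmul]

theorem fockIsometry_const [IsFiniteMeasure (fockMeasure ψ)] :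
    fockIsometry ψ (Lp.const 2 (fockMeasure ψ) (1 : ℂ)) = ψ := by
  ext S
  rw [fockIsometry_apply, mul_apply_configOf_congr ψ (Lp.coeFn_const _ _ _)]
  simp

/-- The Koopman weight of a permutation at a configuration in the support. -/
theorem norm_mul_sqrt_rnDeriv [IsFiniteMeasure (fockMeasure ψ)] {g : Equiv.Perm X}
    (hg : (fockMeasure ψ).map (permute g) ≪ fockMeasure ψ) (S : Finset X) :
    ‖ψ S‖ * Real.sqrt (((fockMeasure ψ).map (permute g)).rnDeriv (fockMeasure ψ)
      (configOf S)).toReal = ‖ψ (S.map (g⁻¹).toEmbedding)‖ := by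
  have := Measure.isFiniteMeasure_map (fockMeasure ψ) (permute g)
  have := Measure.haveLebesgueDecomposition_of_sigmaFinite
    ((fockMeasure ψ).map (permute g)) (fockMeasure ψ)
  -- Integrating the density over the atom at `S` gives `|ψ(S)|²` times its value there, equal to
  -- `|ψ(g⁻¹S)|²`.
  have h := Measure.setLIntegral_rnDeriv hg {configOf S}
  rw [lintegral_singleton, fockMeasure_singleton, map_permute_singleton] at h
  have h1 := congrArg ENNReal.toReal h
  rw [ENNReal.toReal_mul] at h1
  simp only [ENNReal.toReal_pow, toReal_enorm] at h1
  rw [← Real.sqrt_sq (norm_nonneg (ψ (S.map (g⁻¹).toEmbedding))), ← h1,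
    Real.sqrt_mul ENNReal.toReal_nonneg, Real.sqrt_sq (norm_nonneg _), mul_comm]

/-- The point process of a non-negative quasi-free vector with a fixed number of particles is
perfect if it is quasi-invariant. -/
theorem isPerfect_fockMeasure [LinearOrder X] [LocallyFiniteOrder X] {ψ : Fock X} {n : ℕ}
    [IsProbabilityMeasure (fockMeasure ψ)] (hq : IsQuasiInvariant (fockMeasure ψ))
    (hpos : ∀ S, 0 ≤ ψ S) (hcard : ∀ S, S.card ≠ n → ψ S = 0)
    (hpol : IsPolarized (fun f => fockRep (CAR.B (doubledInvolution X) f)) ψ) :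
    IsPerfect (fockMeasure ψ) := by
  have hψ : ψ ≠ 0 := by
    intro h
    have := hpol.norm_eq_one
    rw [h, norm_zero] at this
    exact zero_ne_one this
  -- By quasi-invariance `ψ` is nonzero on all sets of size `n`, so the range of the isometry is the
  -- whole `n`-particle sector, which is invariant.
  have hD : ∀ (a : GaugeInvariant X) (l : Lp ℂ 2 (fockMeasure ψ)),
      ∃ l', gaugeRep a (fockIsometry ψ l) = fockIsometry ψ l' := by
    intro a l
    obtain ⟨l', hl'⟩ := exists_fockIsometry_eq ψ (g := gaugeRep a (fockIsometry ψ l)) fun S hS => by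
      refine gaugeRep_apply_eq_zero (n := n) a (fun T hT => ?_) fun h =>
        ne_zero_of_isQuasiInvariant hψ hcard hq h hS
      rw [fockIsometry_apply, hcard T hT, zero_mul]
    exact ⟨l', hl'.symm⟩
  set T := compression (fockIsometry ψ) gaugeRep hD with hT
  have hTa : ∀ a h S, ψ S * T a h (configOf S) = gaugeRep a (fockIsometry ψ h) S := by
    intro a h S
    rw [← isometry_compression_apply (fockIsometry ψ) gaugeRep hD, fockIsometry_apply]
  refine ⟨hq, T, ⟨fun x h => ?_, fun x y hxy h => ?_⟩, vectorFunctional fockRep ψ,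
    CAR.isQuasiFree_vectorFunctional fockRep hpol, fun A => ?_⟩
  · refine (ae_fockMeasure_iff ψ).2 fun S hS => mul_left_cancel₀ hS ?_
    rw [hTa, gaugeRep_eta_apply, fockIsometry_apply]
    simp only [configOf_apply]
    ring
  · refine (ae_fockMeasure_iff ψ).2 fun S hS => mul_left_cancel₀ hS ?_
    -- Nonnegativity enters only here: without it the weight would be the Koopman factor times a
    -- phase.
    have hnorm : ∀ S, ψ S = ((‖ψ S‖ : ℝ) : ℂ) := fun S => (Complex.norm_of_nonneg' (hpos S)).symm
    have hs := norm_mul_sqrt_rnDeriv ψ (hq _ (finite_support_swap x y)).2 S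
    rw [Equiv.swap_inv] at hs
    rw [hTa, gaugeRep_swapElt_apply hxy, fockIsometry_apply]
    beta_reduce
    rw [permute_configOf, Equiv.swap_inv,
      hnorm S, mul_left_comm, ← Complex.ofReal_mul, hs, ← hnorm, mul_comm]
  · rw [vectorFunctional_apply, ← (fockIsometry ψ).inner_map_map,
      isometry_compression_apply (fockIsometry ψ) gaugeRep hD, fockIsometry_const]
    rfl

/-! ## The main results -/

theorem existsUnique_isDPP {X : Type*} [LinearOrder X] {n : ℕ} {v : Fin n → EllTwo X}
    (hv : LinearIndependent ℂ v) : ∃! M : Measure (Config X), IsDPP M (spanKernel v) :=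
  ⟨fockMeasure (slaterUnit v), isDPP_fockMeasure_slaterUnit hv,
    fun _ hM => hM.unique (isDPP_fockMeasure_slaterUnit hv)⟩

theorem isPerfect_of_isDPP [LinearOrder X] [LocallyFiniteOrder X] {n : ℕ} {v : Fin n → EllTwo X}
    (hv : LinearIndependent ℂ v) (hpos : NonnegMinors v) (M : Measure (Config X))
    [IsProbabilityMeasure M] (hM : IsDPP M (spanKernel v)) (hq : IsQuasiInvariant M) :
    IsPerfect M := by
  obtain rfl := hM.unique (isDPP_fockMeasure_slaterUnit hv)
  exact isPerfect_fockMeasure hq (slaterUnit_apply_nonneg hpos)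
    (fun S hS => slaterUnit_apply_of_card_ne hS) (isPolarized_slaterUnit hv)

/-- The amplitude at a set of size `n` is a nonzero normalisation times a nonvanishing minor, so all
such sets are atoms. -/
theorem isQuasiInvariant_of_isDPP [LinearOrder X] {n : ℕ} {v : Fin n → EllTwo X}
    (hv : LinearIndependent ℂ v)
    (hne : ∀ x : Fin n → X, StrictAnti x → (Matrix.of fun i j => v i (x j)).det ≠ 0)
    {M : Measure (Config X)} (hM : IsDPP M (spanKernel v)) : IsQuasiInvariant M := by
  obtain rfl := hM.unique (isDPP_fockMeasure_slaterUnit hv)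
  refine isQuasiInvariant_fockMeasure (n := n) fun S => ⟨fun h => ?_, fun h => ?_⟩
  · by_contra h'
    exact h (slaterUnit_apply_of_card_ne h')
  · obtain ⟨x, hx, rfl⟩ := exists_strictAnti_image_eq h
    rw [slaterUnit_apply, slater_apply_image v hx]
    exact mul_ne_zero (by simpa using slater_ne_zero v hv) (hne x hx)

end LTwo

/-! ### Weighted monomials and Vandermonde determinants -/

section OrthogonalPolynomials

variable {X : Set ℝ} {N : ℕ} {W : X → ℝ}

/-- The function `x ↦ x^k W(x)^{1/2}` as an element of `ℓ²`. -/
noncomputable def monomialVec (hW : ∀ x, 0 < W x) (k : ℕ)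
    (hs : Summable fun x : X => (x : ℝ) ^ (2 * k) * W x) : EllTwo X :=
  ⟨fun x => (((x : ℝ) ^ k * Real.sqrt (W x) : ℝ) : ℂ), EllTwo.memℓp_of_summable (by
    refine hs.congr fun x => ?_
    rw [Complex.norm_real, Real.norm_eq_abs, sq_abs, mul_pow, Real.sq_sqrt (hW x).le, ← pow_mul,
      mul_comm k])⟩

/-- Vandermonde's determinant for decreasing points and exponents. -/
theorem det_monomials_pos (hW : ∀ x, 0 < W x) {x : Fin N → X} (hx : StrictAnti x) :
    0 < (Matrix.of fun i j : Fin N =>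
      (x j : ℝ) ^ (N - 1 - (i : ℕ)) * Real.sqrt (W (x j))).det := by
  -- Reversing both indices leaves the determinant unchanged and turns decreasing points and
  -- exponents into increasing ones, as in the standard Vandermonde matrix.
  have h1 : (Matrix.of fun i j : Fin N => (x j : ℝ) ^ (N - 1 - (i : ℕ)) * Real.sqrt (W (x j)))
      = Matrix.of fun i j => Real.sqrt (W (x j)) *
        ((Matrix.vandermonde fun i : Fin N => (x i.rev : ℝ)).transpose.submatrix
          Fin.revPerm Fin.revPerm) i j := by
    ext i j
    simp only [Matrix.of_apply, Matrix.submatrix_apply, Matrix.transpose_apply,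
      Matrix.vandermonde_apply, Fin.revPerm_apply, Fin.rev_rev, Fin.val_rev]
    rw [mul_comm, show N - 1 - (i : ℕ) = N - (i + 1) by omega]
  rw [h1, Matrix.det_mul_row, Matrix.det_submatrix_equiv_self, Matrix.det_transpose,
    Matrix.det_vandermonde]
  refine mul_pos (Finset.prod_pos fun j _ => Real.sqrt_pos.2 (hW _))
    (Finset.prod_pos fun i _ => Finset.prod_pos fun j hj => sub_pos.2 ?_)
  exact hx (Fin.rev_lt_rev.2 (Finset.mem_Ioi.1 hj))

/-- Evaluation at the points `x j` sends the `v i` to the rows of an invertible matrix. -/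
theorem linearIndependent_of_det_ne_zero {ι : Type*} {n : ℕ} (v : Fin n → EllTwo ι)
    (x : Fin n → ι) (h : (Matrix.of fun i j => v i (x j)).det ≠ 0) : LinearIndependent ℂ v := by
  let E : EllTwo ι →ₗ[ℂ] (Fin n → ℂ) := LinearMap.pi fun j =>
    (lp.evalCLM ℂ (fun _ : ι => ℂ) 2 (x j)).toLinearMap
  refine LinearIndependent.of_comp E ?_
  exact Matrix.linearIndependent_rows_of_det_ne_zero h

end OrthogonalPolynomials

theorem countable_and_infinite_of_orderIso {X : Type*} [LE X]
    (h : Nonempty (X ≃o ℤ) ∨ Nonempty (X ≃o ℕ)) : Countable X ∧ Infinite X := by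
  rcases h with ⟨⟨e⟩⟩ | ⟨⟨e⟩⟩ <;>
    exact ⟨e.injective.countable, Infinite.of_injective e.symm e.symm.injective⟩

theorem mainTheorem8 :
    (∀ (X : Type*) [LinearOrder X] [LocallyFiniteOrder X],
      (Nonempty (X ≃o ℤ) ∨ Nonempty (X ≃o ℕ)) →
      ∀ (N : ℕ) (v : Fin N → EllTwo X),
        LinearIndependent ℂ v →
        NonnegMinors v →
        (∃! M : MeasureTheory.Measure (Config X), IsDPP M (spanKernel v)) ∧
        ∀ (M : MeasureTheory.Measure (Config X)) [MeasureTheory.IsProbabilityMeasure M],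
          IsDPP M (spanKernel v) → IsQuasiInvariant M → IsPerfect M) ∧
    (∀ (X : Set ℝ) [LocallyFiniteOrder X],
      (Nonempty (X ≃o ℤ) ∨ Nonempty (X ≃o ℕ)) →
      ∀ (N : ℕ) (W : X → ℝ),
        (∀ x, 0 < W x) →
        (∀ k < N, Summable fun x : X => (x : ℝ) ^ (2 * k) * W x) →
        ∃ v : Fin N → EllTwo X,
          (∀ (i : Fin N) (x : X),
            v i x = (((x : ℝ) ^ (N - 1 - (i : ℕ)) * Real.sqrt (W x) : ℝ) : ℂ)) ∧
          LinearIndependent ℂ v ∧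
          NonnegMinors v ∧
          (∃! M : MeasureTheory.Measure (Config X), IsDPP M (spanKernel v)) ∧
          ∀ (M : MeasureTheory.Measure (Config X)) [MeasureTheory.IsProbabilityMeasure M],
            IsDPP M (spanKernel v) → IsPerfect M) := by
  refine ⟨fun X _ _ hX N v hv hpos => ?_, fun X _ hX N W hW hs => ?_⟩
  · have := (countable_and_infinite_of_orderIso hX).1
    exact ⟨existsUnique_isDPP hv, fun M _ hM hq => isPerfect_of_isDPP hv hpos M hM hq⟩
  · obtain ⟨_, _⟩ := countable_and_infinite_of_orderIso hX
    set v : Fin N → EllTwo X := fun i =>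
      monomialVec hW (N - 1 - (i : ℕ)) (hs _ (by omega))
    have hdet : ∀ x : Fin N → X, StrictAnti x → 0 < (Matrix.of fun i j => v i (x j)).det := by
      intro x hx
      have h1 : (Matrix.of fun i j => v i (x j)) = Complex.ofRealHom.mapMatrix
          (Matrix.of fun i j : Fin N =>
            (x j : ℝ) ^ (N - 1 - (i : ℕ)) * Real.sqrt (W (x j))) := rfl
      rw [h1, ← RingHom.map_det]
      exact Complex.zero_lt_real.2 (det_monomials_pos hW hx)
    -- Independence needs just one nonvanishing minor, and an infinite `X` supplies `N` points for
    -- it.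
    obtain ⟨S, hS⟩ := Infinite.exists_subset_card_eq X N
    obtain ⟨x, hx, -⟩ := exists_strictAnti_image_eq hS
    have hv : LinearIndependent ℂ v := linearIndependent_of_det_ne_zero v x (hdet x hx).ne'
    refine ⟨v, fun i x => rfl, hv, fun x hx => (hdet x hx).le, existsUnique_isDPP hv,
      fun M _ hM => isPerfect_of_isDPP hv (fun x hx => (hdet x hx).le) M hM
        (isQuasiInvariant_of_isDPP hv (fun x hx => (hdet x hx).ne') hM)⟩
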